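/- **Setting (rank potentialism).** Let $V$ be the universe of sets and let $\mathcal V=\{V_\beta\mid\beta\in\mathrm{Ord}\}$, where each world is the $\in$-structure $\langle V_\beta,\in\rangle$ and $V_\beta$ accesses $V_\gamma$ iff $V_\beta\subseteq V_\gamma$. Formulas of the language of set theory augmented with $\Box,\Diamond$ are evaluated at a world in the usual Kripke manner: quantifiers range over the elements of the current world, and $\Box\varphi$ (resp. $\Diamond\varphi$) holds at $V_\beta$ iff $\varphi$ holds at all (resp. some) accessed worlds $V_\gamma$. A propositional modal formula $\varphi(p_0,\dots,p_n)$ is valid at $V_\delta$ for a class of assertions if $\varphi(\psi_0,\dots,\psi_n)$ is true at $V_\delta$ for all $\psi_0,\dots,\psi_n$ in that class. Let $\mathrm{Val}_{\mathcal V}(V_\delta,\mathcal L_{\in,V_\delta})$ and $\mathrm{Val}_{\mathcal V}(V_\delta,\mathcal L_\in)$ be the sets of propositional modal formulas valid at $V_\delta$ for assertions of the (non-modal) language of set theory, with parameters from $V_\delta$ and without parameters respectively. Let $\mathrm{S5}$ be the set of theorems of the propositional modal logic S5. An ordinal $\delta$ is $\Sigma_3$-correct, $V_\delta\prec_{\Sigma_3}V$,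 if $V_\delta$ and $V$ agree on the truth of all $\Sigma_3$ formulas (in the Lévy hierarchy) with parameters from $V_\delta$. **Theorem.** For every ordinal $\delta$ the following are equivalent: 1. $V_\delta$ satisfies the rank-potentialist maximality principle: $\mathrm{S5}\subseteq\mathrm{Val}_{\mathcal V}(V_\delta,\mathcal L_{\in,V_\delta})$. 2. $\mathrm{Val}_{\mathcal V}(V_\delta,\mathcal L_{\in,V_\delta})=\mathrm{S5}$. 3. The axiom $\Diamond\Box p\to p$ is valid at $V_\delta$ for assertions of the language of set theory with parameters from $V_\delta$. 4. $\delta$ is $\Sigma_3$-correct. If $\delta$ is $\Sigma_3$-correct, then also $\mathrm{Val}_{\mathcal V}(V_\delta,\mathcal L_\in)=\mathrm{S5}$. Moreover, the class of $\Sigma_3$-correct ordinals is closed and unbounded in the ordinals. Consequently the class of ordinals $\delta$ with $\mathrm{Val}_{\mathcal V}(V_\delta,\mathcal L_{\in,V_\delta})=\mathrm{Val}_{\mathcal V}(V_\delta,\mathcal L_\in)=\mathrm{S5}$ is closed and unbounded in the ordinals. -/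

import Mathlib

universe u

namespace RankPotentialism

open FirstOrder FirstOrder.Language
open scoped ZFSet

/-! ### The language of set theory, the universe `V` and the worlds `V_β` -/

/-- The only non-logical symbol of the language of set theory: a binary relation symbol. -/
inductive SetRel : ℕ → Type
  | mem : SetRel 2

/-- The first-order language `{∈}` of set theory. -/
def LSet : Language := ⟨fun _ => Empty, SetRel⟩

/-- The universe of sets `⟨V, ∈⟩`. -/
instance : LSet.Structure ZFSet.{u} where
  funMap := fun f => f.elim
  RelMap | .mem => fun xs => xs 0 ∈ xs 1

/-- The domain of the world `V_β`. -/
def World (β : Ordinal.{u}) : Type (u + 1) := {x : ZFSet.{u} // x ∈ V_ β}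

/-- The world `⟨V_β, ∈⟩`. -/
instance (β : Ordinal.{u}) : LSet.Structure (World β) where
  funMap := fun f => f.elim
  RelMap | .mem => fun xs => (xs 0).1 ∈ (xs 1).1

/-- The inclusion of a world into a larger world. -/
def World.incl {β γ : Ordinal.{u}} (h : V_ β ⊆ V_ γ) (x : World β) : World γ := ⟨x.1, h x.2⟩

/-! ### The Lévy hierarchy and correctness -/

section Levy

variable {α : Type*}

/-- The atomic formula `x ∈ y`. -/
def memFormula {n : ℕ} (x y : α ⊕ Fin n) : LSet.BoundedFormula α n :=
  BoundedFormula.rel (L := LSet) SetRel.mem ![Term.var x, Term.var y]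

/-- `∀ x ∈ y, φ(x)`, where `x` is the newly bound variable and `y` is an older variable. -/
def boundedAll {n : ℕ} (y : α ⊕ Fin n) (φ : LSet.BoundedFormula α (n + 1)) :
    LSet.BoundedFormula α n :=
  (memFormula (Sum.inr (Fin.last n)) (Sum.map id Fin.castSucc y) ⟹ φ).all

/-- `∃ x ∈ y, φ(x)`, where `x` is the newly bound variable and `y` is an older variable. -/
def boundedEx {n : ℕ} (y : α ⊕ Fin n) (φ : LSet.BoundedFormula α (n + 1)) :
    LSet.BoundedFormula α n :=
  (memFormula (Sum.inr (Fin.last n)) (Sum.map id Fin.castSucc y) ⊓ φ).ex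

/-- The `Δ₀` formulas: all quantifiers are bounded. (The other connectives are abbreviations by
means of `→` and `⊥`.) -/
inductive IsDelta0 : ∀ {n : ℕ}, LSet.BoundedFormula α n → Prop
  | falsum {n : ℕ} : IsDelta0 (BoundedFormula.falsum (n := n))
  | equal {n : ℕ} (t₁ t₂ : LSet.Term (α ⊕ Fin n)) : IsDelta0 (BoundedFormula.equal t₁ t₂)
  | rel {n l : ℕ} (R : LSet.Relations l) (ts : Fin l → LSet.Term (α ⊕ Fin n)) :
      IsDelta0 (BoundedFormula.rel R ts)
  | imp {n : ℕ} {φ ψ : LSet.BoundedFormula α n} :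
      IsDelta0 φ → IsDelta0 ψ → IsDelta0 (φ.imp ψ)
  | ball {n : ℕ} (y : α ⊕ Fin n) {φ : LSet.BoundedFormula α (n + 1)} :
      IsDelta0 φ → IsDelta0 (boundedAll y φ)
  | bex {n : ℕ} (y : α ⊕ Fin n) {φ : LSet.BoundedFormula α (n + 1)} :
      IsDelta0 φ → IsDelta0 (boundedEx y φ)

/-- A finite (possibly empty) block of existential quantifiers in front of a formula in `P`. -/
inductive ExBlock (P : ∀ n : ℕ, LSet.BoundedFormula α n → Prop) :
    ∀ n : ℕ, LSet.BoundedFormula α n → Prop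
  | base {n : ℕ} {φ : LSet.BoundedFormula α n} : P n φ → ExBlock P n φ
  | ex {n : ℕ} {φ : LSet.BoundedFormula α (n + 1)} : ExBlock P (n + 1) φ → ExBlock P n φ.ex

/-- A finite (possibly empty) block of universal quantifiers in front of a formula in `P`. -/
inductive AllBlock (P : ∀ n : ℕ, LSet.BoundedFormula α n → Prop) :
    ∀ n : ℕ, LSet.BoundedFormula α n → Prop
  | base {n : ℕ} {φ : LSet.BoundedFormula α n} : P n φ → AllBlock P n φ
  | all {n : ℕ} {φ : LSet.BoundedFormula α (n + 1)} : AllBlock P (n + 1) φ → AllBlock P n φ.all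

mutual

/-- The `Σ_k` formulas of the Lévy hierarchy. -/
def IsSigma : ℕ → ∀ n : ℕ, LSet.BoundedFormula α n → Prop
  | 0 => fun _ φ => IsDelta0 φ
  | k + 1 => ExBlock (IsPi k)

/-- The `Π_k` formulas of the Lévy hierarchy. -/
def IsPi : ℕ → ∀ n : ℕ, LSet.BoundedFormula α n → Prop
  | 0 => fun _ φ => IsDelta0 φ
  | k + 1 => AllBlock (IsSigma k)

end

end Levy

/-- `δ` is `Σ_k`-correct, `V_δ ≺_{Σ_k} V`: the structures `V_δ` and `V` agree on the truth of `Σ_k`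
formulas with parameters from `V_δ`. -/
def SigmaCorrect (k : ℕ) (δ : Ordinal.{u}) : Prop :=
  ∀ (m : ℕ) (φ : LSet.Formula (Fin m)), IsSigma k 0 φ → ∀ a : Fin m → World δ,
    φ.Realize a ↔ φ.Realize (fun i => (a i).1 : Fin m → ZFSet.{u})

/-! ### The potentialist language and its semantics in the system of all worlds `V_β` -/

/-- Formulas of the potentialist language: the language of set theory augmented with the modal
operator `□` (with `◇` abbreviating `¬□¬`). As for `BoundedFormula`, the free variables are indexed
by `α` and by `Fin n`. -/
inductive PotFormula (α : Type*) : ℕ → Type _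
  | falsum {n : ℕ} : PotFormula α n
  | equal {n : ℕ} (t₁ t₂ : LSet.Term (α ⊕ Fin n)) : PotFormula α n
  | rel {n l : ℕ} (R : LSet.Relations l) (ts : Fin l → LSet.Term (α ⊕ Fin n)) : PotFormula α n
  | imp {n : ℕ} (φ ψ : PotFormula α n) : PotFormula α n
  | all {n : ℕ} (φ : PotFormula α (n + 1)) : PotFormula α n
  | box {n : ℕ} (φ : PotFormula α n) : PotFormula α n

/-- Potentialist truth at the world `V_β`: quantifiers range over the individuals of that world, and
`□` refers to all worlds `V_γ` that include it. -/
def PotFormula.Realize {α : Type*} : ∀ {n : ℕ}, PotFormula α n →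
    ∀ β : Ordinal.{u}, (α → World β) → (Fin n → World β) → Prop
  | _, .falsum, _, _, _ => False
  | _, .equal t₁ t₂, _, v, xs => t₁.realize (Sum.elim v xs) = t₂.realize (Sum.elim v xs)
  | _, .rel R ts, _, v, xs => Structure.RelMap R fun i => (ts i).realize (Sum.elim v xs)
  | _, .imp φ ψ, β, v, xs => φ.Realize β v xs → ψ.Realize β v xs
  | _, .all φ, β, v, xs => ∀ x : World β, φ.Realize β v (Fin.snoc xs x)
  | _, .box φ, β, v, xs => ∀ (γ : Ordinal.{u}) (h : V_ β ⊆ V_ γ),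
      φ.Realize γ (World.incl h ∘ v) (World.incl h ∘ xs)

/-- Formulas of the language of set theory are formulas of the potentialist language. -/
def PotFormula.ofFormula {α : Type*} : ∀ {n : ℕ}, LSet.BoundedFormula α n → PotFormula α n
  | _, .falsum => .falsum
  | _, .equal t₁ t₂ => .equal t₁ t₂
  | _, .rel R ts => .rel R ts
  | _, .imp φ ψ => .imp (ofFormula φ) (ofFormula ψ)
  | _, .all φ => .all (ofFormula φ)

/-! ### Propositional modal logic -/

/-- Propositional modal formulas in the propositional variables `p₀, p₁, …`. -/
inductive ModalFormula : Type
  | var (i : ℕ) : ModalFormula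
  | bot : ModalFormula
  | imp (φ ψ : ModalFormula) : ModalFormula
  | box (φ : ModalFormula) : ModalFormula

namespace ModalFormula

/-- `¬φ`. -/
def neg (φ : ModalFormula) : ModalFormula := φ.imp bot

/-- `◇φ`, that is, `¬□¬φ`. -/
def dia (φ : ModalFormula) : ModalFormula := φ.neg.box.neg

/-- The truth value of a formula when its propositional variables and its subformulas `□φ` get
arbitrary truth values. -/
def propEval (v : ModalFormula → Prop) : ModalFormula → Prop
  | var i => v (var i)
  | bot => False
  | imp φ ψ => φ.propEval v → ψ.propEval v
  | box φ => v (box φ)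

/-- The result `φ(ψ₀, ψ₁, …)` of substituting formulas of the potentialist language for the
propositional variables. -/
def subst {α : Type*} (ψ : ℕ → PotFormula α 0) : ModalFormula → PotFormula α 0
  | var i => ψ i
  | bot => .falsum
  | imp φ χ => .imp (φ.subst ψ) (χ.subst ψ)
  | box φ => .box (φ.subst ψ)

end ModalFormula

open ModalFormula in
/-- Theorems of the modal logic S5. -/
inductive S5Provable : ModalFormula → Prop
  | taut {φ : ModalFormula} : (∀ v : ModalFormula → Prop, φ.propEval v) → S5Provable φ
  | axiomK (φ ψ : ModalFormula) : S5Provable ((φ.imp ψ).box.imp (φ.box.imp ψ.box))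
  | axiomT (φ : ModalFormula) : S5Provable (φ.box.imp φ)
  | axiomFour (φ : ModalFormula) : S5Provable (φ.box.imp φ.box.box)
  | axiomFive (φ : ModalFormula) : S5Provable (φ.box.dia.imp φ)
  | mp {φ ψ : ModalFormula} : S5Provable (φ.imp ψ) → S5Provable φ → S5Provable ψ
  | nec {φ : ModalFormula} : S5Provable φ → S5Provable φ.box

/-- The modal theory S5. -/
def S5 : Set ModalFormula := {φ | S5Provable φ}

/-! ### Validities of a world and the maximality principle -/

/-- The modal formulas all of whose substitution instances by formulas of the language of set theory
in the variables `α`, interpreted by `v`, are true at the world `V_δ`. -/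
def validities {α : Type*} (δ : Ordinal.{u}) (v : α → World δ) : Set ModalFormula :=
  {φ | ∀ ψ : ℕ → LSet.Formula α,
    (φ.subst fun i => PotFormula.ofFormula (ψ i)).Realize δ v Fin.elim0}

/-- The validities of the world `V_δ` for assertions in the language of set theory with parameters
from `V_δ`: every element of `V_δ` is available as a name for itself. -/
def valParam (δ : Ordinal.{u}) : Set ModalFormula := validities δ (id : World δ → World δ)

/-- The validities of the world `V_δ` for sentences in the language of set theory, without
parameters. -/
def valSentence (δ : Ordinal.{u}) : Set ModalFormula := validities δ (Empty.elim : Empty → World δ)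

/-- The rank-potentialist maximality principle at `V_δ`: the modal theory S5 is valid at `V_δ` for
assertions in the language of set theory with parameters from `V_δ`. -/
def MaximalityPrinciple (δ : Ordinal.{u}) : Prop := S5 ⊆ valParam δ

end RankPotentialism

-- Validity of `◇□p → p` at `V_δ` says that an assertion with parameters in `V_δ` that is true in
-- all sufficiently large `V_γ` is already true in `V_δ` (`diaBox_mem_valParam_iff`). The theorem
-- compares this reflection property with `Σ₃`-correctness.
--
-- From correctness to S5: "φ is eventually true" is `Σ₃`, of the form "there is `W` such that every
-- level containing `W` satisfies φ", where the part after `W` is `Π₂`. A `Σ₃`-correct `V_δ`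
-- contains such a `W`, and it works in `V` too, so φ holds in every `V_γ` with `γ ≥ δ`
-- (`SigmaCorrect.holds_of_eventually`). Hence every boxed formula has a constant truth value from
-- `δ` on, and S5 is valid (`forces_of_s5Provable`).
--
-- From reflection to correctness: call `V_l` a collapse world if it is a limit level with an
-- infinite element and contains Mostowski collapses of its well-founded relations. One sentence
-- expresses this, and it is true in `V`, so such worlds are unbounded. Each is `Σ₁`-correct: a
-- Löwenheim–Skolem hull of a large world can be coded on some `V_ξ` with `ξ < l` and collapsed
-- inside `V_l` (`HasCollapses.sat_of_sigma_one`). Collapse worlds therefore inherit true `Π₂`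
-- statements, which turns `Σ₃` truth in `V` into eventual truth of another assertion
-- (`exists_eventual_formula`); reflection brings it to `V_δ`.
--
-- Nothing beyond S5 is ever valid: the finite part of `γ` is definable in `V_γ`, and each of its
-- values recurs unboundedly, so the worlds can imitate any finite universal Kripke model
-- (`validities_subset_s5`, with `exists_not_evalS5` for completeness). Fully elementary worlds give
-- unboundedness of the club; closure follows from the reflection property, since an assertion has
-- only finitely many parameters.

namespace RankPotentialism

open FirstOrder FirstOrder.Language
open scoped ZFSet

/-! ### Satisfaction in classes of sets -/

section Satisfaction

variable {α β : Type*} {n N : ℕ}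

/-- The variable that a term of the language of set theory consists of. -/
def termVar : LSet.Term β → β
  | .var x => x
  | .func f _ => f.elim

theorem var_termVar : ∀ t : LSet.Term β, Term.var (termVar t) = t
  | .var _ => rfl
  | .func f _ => f.elim

theorem realize_eq_termVar {M : Type*} [LSet.Structure M] (t : LSet.Term β) (s : β → M) :
    t.realize s = s (termVar t) := by
  conv_lhs => rw [← var_termVar t]
  rfl

/-- The assignment `s`, with the value `x` for the newly bound variable. -/
def assign {γ : Type*} (s : α ⊕ Fin n → γ) (x : γ) : α ⊕ Fin (n + 1) → γ :=
  Sum.elim (s ∘ Sum.inl) (Fin.snoc (s ∘ Sum.inr) x : Fin (n + 1) → γ)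

/-- An older variable, in the scope of a new quantifier. -/
def up (y : α ⊕ Fin n) : α ⊕ Fin (n + 1) := Sum.map id Fin.castSucc y

/-- The newly bound variable. -/
def top : α ⊕ Fin (n + 1) := Sum.inr (Fin.last n)

@[simp] theorem assign_top {γ : Type*} (s : α ⊕ Fin n → γ) (x : γ) : assign s x top = x := by
  simp [assign, top]

@[simp] theorem assign_up {γ : Type*} (s : α ⊕ Fin n → γ) (x : γ) (y : α ⊕ Fin n) :
    assign s x (up y) = s y := by
  rcases y with y | y <;> simp [assign, up]

@[simp] theorem assign_comp_up {γ : Type*} (s : α ⊕ Fin n → γ) (x : γ) :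
    assign s x ∘ up = s := by
  ext y; simp

theorem forall_var {p : α ⊕ Fin (n + 1) → Prop} :
    (∀ y, p y) ↔ (∀ y, p (up y)) ∧ p top := by
  constructor
  · exact fun h => ⟨fun y => h _, h _⟩
  · rintro ⟨h, h'⟩ (y | y)
    · exact h (Sum.inl y)
    · induction y using Fin.lastCases with
      | last => exact h'
      | cast i => exact h (Sum.inr i)

theorem comp_assign {γ γ' : Type*} (g : γ → γ') (s : α ⊕ Fin n → γ) (x : γ) :
    g ∘ assign s x = assign (g ∘ s) (g x) := by
  funext y
  revert y
  rw [forall_var]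
  simp

theorem assign_mem {A : Set ZFSet.{u}} {s : α ⊕ Fin n → ZFSet.{u}} {x : ZFSet.{u}}
    (hs : ∀ i, s i ∈ A) (hx : x ∈ A) : ∀ i, assign s x i ∈ A := by
  rw [forall_var]
  exact ⟨fun y => by simpa using hs y, by simpa using hx⟩

/-- Truth of a formula in the class `A` of sets, for arbitrary sets as values of the variables. -/
def Sat (A : Set ZFSet.{u}) : ∀ {n : ℕ}, LSet.BoundedFormula α n → (α ⊕ Fin n → ZFSet.{u}) → Prop
  | _, .falsum, _ => False
  | _, .equal t₁ t₂, s => s (termVar t₁) = s (termVar t₂)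
  | _, .rel R ts, s => Structure.RelMap R fun i => s (termVar (ts i))
  | _, .imp φ ψ, s => Sat A φ s → Sat A ψ s
  | _, .all φ, s => ∀ x ∈ A, Sat A φ (assign s x)

theorem elim_snoc {M : Type*} (v : α → M) (xs : Fin n → M) (x : M) :
    Sum.elim v (Fin.snoc xs x : Fin (n + 1) → M) = assign (Sum.elim v xs) x := by
  simp [assign]

/-- All structures that occur (`V`, the worlds, elementary hulls and their collapses) are classes of
sets up to an injection, so `Sat` allows absoluteness to be argued for classes only. A hull is read
through two injections: inclusion and collapse. -/
theorem realize_iff_sat {M : Type*} [LSet.Structure M] (ι : M → ZFSet.{u})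
    (hι : Function.Injective ι)
    (hmem : ∀ xs : Fin 2 → M, Structure.RelMap (L := LSet) SetRel.mem xs ↔ ι (xs 0) ∈ ι (xs 1))
    (φ : LSet.BoundedFormula α n) (v : α → M) (xs : Fin n → M) :
    φ.Realize v xs ↔ Sat (Set.range ι) φ (ι ∘ Sum.elim v xs) := by
  induction φ with
  | falsum => rfl
  | equal t₁ t₂ => simp [BoundedFormula.Realize, Sat, realize_eq_termVar, hι.eq_iff]
  | rel R ts =>
    cases R
    simp only [BoundedFormula.Realize, Sat, realize_eq_termVar]
    exact hmem _
  | imp φ ψ h₁ h₂ => simp only [BoundedFormula.Realize, Sat, h₁, h₂]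
  | all φ h => simp [BoundedFormula.Realize, Sat, h, elim_snoc, comp_assign]

theorem realize_zfset (φ : LSet.BoundedFormula α n) (v : α → ZFSet.{u}) (xs : Fin n → ZFSet.{u}) :
    φ.Realize v xs ↔ Sat Set.univ φ (Sum.elim v xs) := by
  rw [realize_iff_sat id Function.injective_id fun xs => Iff.rfl]
  simp

theorem range_world (δ : Ordinal.{u}) :
    Set.range (fun x : World δ => x.1) = (V_ δ : Set ZFSet.{u}) := by
  ext x
  exact ⟨fun ⟨y, hy⟩ => hy ▸ y.2, fun h => ⟨⟨x, h⟩, rfl⟩⟩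

theorem realize_world {δ : Ordinal.{u}} (φ : LSet.BoundedFormula α n) (v : α → World δ)
    (xs : Fin n → World δ) :
    φ.Realize v xs ↔ Sat (V_ δ : Set ZFSet.{u}) φ (fun i => (Sum.elim v xs i).1) := by
  rw [realize_iff_sat (fun x : World δ => x.1) Subtype.val_injective fun xs => Iff.rfl, range_world]
  rfl

section Connectives

variable (A : Set ZFSet.{u}) (s : α ⊕ Fin n → ZFSet.{u})

@[simp] theorem sat_imp (φ ψ : LSet.BoundedFormula α n) :
    Sat A (φ.imp ψ) s ↔ (Sat A φ s → Sat A ψ s) := Iff.rfl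

@[simp] theorem sat_bot : Sat A (⊥ : LSet.BoundedFormula α n) s ↔ False := Iff.rfl

@[simp] theorem sat_not (φ : LSet.BoundedFormula α n) : Sat A (∼φ) s ↔ ¬ Sat A φ s := Iff.rfl

@[simp] theorem sat_inf (φ ψ : LSet.BoundedFormula α n) :
    Sat A (φ ⊓ ψ) s ↔ Sat A φ s ∧ Sat A ψ s := by
  change ((Sat A φ s → (Sat A ψ s → False)) → False) ↔ _
  tauto

@[simp] theorem sat_sup (φ ψ : LSet.BoundedFormula α n) :
    Sat A (φ ⊔ ψ) s ↔ Sat A φ s ∨ Sat A ψ s := by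
  change ((Sat A φ s → False) → Sat A ψ s) ↔ _
  tauto

@[simp] theorem sat_iff (φ ψ : LSet.BoundedFormula α n) :
    Sat A (φ.iff ψ) s ↔ (Sat A φ s ↔ Sat A ψ s) := by
  simp only [BoundedFormula.iff, sat_inf, sat_imp, iff_iff_implies_and_implies]

@[simp] theorem sat_all (φ : LSet.BoundedFormula α (n + 1)) :
    Sat A φ.all s ↔ ∀ x ∈ A, Sat A φ (assign s x) := Iff.rfl

@[simp] theorem sat_ex (φ : LSet.BoundedFormula α (n + 1)) :
    Sat A φ.ex s ↔ ∃ x ∈ A, Sat A φ (assign s x) := by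
  simp [BoundedFormula.ex]

@[simp] theorem sat_mem (x y : α ⊕ Fin n) : Sat A (memFormula x y) s ↔ s x ∈ s y := Iff.rfl

/-- The atomic formula `x = y`. -/
def eqFormula (x y : α ⊕ Fin n) : LSet.BoundedFormula α n := .equal (.var x) (.var y)

@[simp] theorem sat_eq (x y : α ⊕ Fin n) : Sat A (eqFormula x y) s ↔ s x = s y := Iff.rfl

theorem sat_boundedAll (y : α ⊕ Fin n) (φ : LSet.BoundedFormula α (n + 1)) :
    Sat A (boundedAll y φ) s ↔ ∀ x ∈ A, x ∈ s y → Sat A φ (assign s x) := by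
  change (∀ x ∈ A, assign s x top ∈ assign s x (up y) → _) ↔ _
  simp

theorem sat_boundedEx (y : α ⊕ Fin n) (φ : LSet.BoundedFormula α (n + 1)) :
    Sat A (boundedEx y φ) s ↔ ∃ x ∈ A, x ∈ s y ∧ Sat A φ (assign s x) := by
  rw [boundedEx, sat_ex]
  simp only [sat_inf]
  change (∃ x ∈ A, assign s x top ∈ assign s x (up y) ∧ _) ↔ _
  simp

end Connectives

-- Absoluteness between transitive classes

/-- A transitive class. -/
def TransClass (A : Set ZFSet.{u}) : Prop := ∀ x ∈ A, ∀ y ∈ x, y ∈ A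

theorem transClass_univ : TransClass (Set.univ : Set ZFSet.{u}) := fun _ _ _ _ => trivial

theorem transClass_vonNeumann (δ : Ordinal.{u}) : TransClass (V_ δ : Set ZFSet.{u}) :=
  fun _ hx _ hy => ZFSet.isTransitive_vonNeumann δ _ hx hy

theorem TransClass.sat_boundedAll {A : Set ZFSet.{u}} (hA : TransClass A)
    {s : α ⊕ Fin n → ZFSet.{u}} {y : α ⊕ Fin n} (hy : s y ∈ A)
    (φ : LSet.BoundedFormula α (n + 1)) :
    Sat A (boundedAll y φ) s ↔ ∀ x ∈ s y, Sat A φ (assign s x) := by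
  rw [RankPotentialism.sat_boundedAll]
  exact ⟨fun h x hx => h x (hA _ hy _ hx) hx, fun h x _ hx => h x hx⟩

theorem TransClass.sat_boundedEx {A : Set ZFSet.{u}} (hA : TransClass A)
    {s : α ⊕ Fin n → ZFSet.{u}} {y : α ⊕ Fin n} (hy : s y ∈ A)
    (φ : LSet.BoundedFormula α (n + 1)) :
    Sat A (boundedEx y φ) s ↔ ∃ x ∈ s y, Sat A φ (assign s x) := by
  rw [RankPotentialism.sat_boundedEx]
  exact ⟨fun ⟨x, _, h⟩ => ⟨x, h⟩, fun ⟨x, hx, h⟩ => ⟨x, hA _ hy _ hx, hx, h⟩⟩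

theorem IsDelta0.not {φ : LSet.BoundedFormula α n} (h : IsDelta0 φ) : IsDelta0 ∼φ :=
  .imp h .falsum

theorem IsDelta0.inf {φ ψ : LSet.BoundedFormula α n} (h : IsDelta0 φ) (h' : IsDelta0 ψ) :
    IsDelta0 (φ ⊓ ψ) :=
  .not (.imp h h'.not)

theorem IsDelta0.iff {φ ψ : LSet.BoundedFormula α n} (h : IsDelta0 φ) (h' : IsDelta0 ψ) :
    IsDelta0 (φ.iff ψ) :=
  .inf (.imp h h') (.imp h' h)

theorem isDelta0_mem (x y : α ⊕ Fin n) : IsDelta0 (memFormula x y) := .rel _ _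

/-- `Δ₀` formulas are absolute between transitive classes. -/
theorem IsDelta0.absolute {φ : LSet.BoundedFormula α n} (hφ : IsDelta0 φ) {A B : Set ZFSet.{u}}
    (hA : TransClass A) (hB : TransClass B) {s : α ⊕ Fin n → ZFSet.{u}}
    (hsA : ∀ i, s i ∈ A) (hsB : ∀ i, s i ∈ B) : Sat A φ s ↔ Sat B φ s := by
  induction hφ with
  | falsum => rfl
  | equal => rfl
  | rel => rfl
  | imp _ _ h₁ h₂ => simp only [sat_imp, h₁ hsA hsB, h₂ hsA hsB]
  | ball y _ h =>
    rw [hA.sat_boundedAll (hsA y), hB.sat_boundedAll (hsB y)]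
    exact forall₂_congr fun x hx =>
      h (assign_mem hsA (hA _ (hsA y) _ hx)) (assign_mem hsB (hB _ (hsB y) _ hx))
  | bex y _ h =>
    rw [hA.sat_boundedEx (hsA y), hB.sat_boundedEx (hsB y)]
    exact exists_congr fun x => and_congr_right fun hx =>
      h (assign_mem hsA (hA _ (hsA y) _ hx)) (assign_mem hsB (hB _ (hsB y) _ hx))

/-- `Σ₁` formulas are upward absolute between transitive classes. -/
theorem sigma_one_upward {φ : LSet.BoundedFormula α n} (hφ : IsSigma 1 n φ) {A B : Set ZFSet.{u}}
    (hA : TransClass A) (hB : TransClass B) (hAB : A ⊆ B) {s : α ⊕ Fin n → ZFSet.{u}}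
    (hs : ∀ i, s i ∈ A) (h : Sat A φ s) : Sat B φ s := by
  induction hφ with
  | base hφ => exact (IsDelta0.absolute hφ hA hB hs fun i => hAB (hs i)).1 h
  | ex _ ih =>
    rw [sat_ex] at h ⊢
    obtain ⟨x, hx, h⟩ := h
    exact ⟨x, hAB hx, ih (assign_mem hs hx) h⟩

/-- `Π₁` formulas are downward absolute between transitive classes. -/
theorem pi_one_downward {φ : LSet.BoundedFormula α n} (hφ : IsPi 1 n φ) {A B : Set ZFSet.{u}}
    (hA : TransClass A) (hB : TransClass B) (hAB : A ⊆ B) {s : α ⊕ Fin n → ZFSet.{u}}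
    (hs : ∀ i, s i ∈ A) (h : Sat B φ s) : Sat A φ s := by
  induction hφ with
  | base hφ => exact (IsDelta0.absolute hφ hA hB hs fun i => hAB (hs i)).2 h
  | all _ ih => exact fun x hx => ih (assign_mem hs hx) (h x (hAB hx))

theorem vonNeumann_subset_coe {β γ : Ordinal.{u}} (h : β ≤ γ) :
    (V_ β : Set ZFSet.{u}) ⊆ (V_ γ : Set ZFSet.{u}) := fun _ hx =>
  ZFSet.vonNeumann_subset_of_le h hx

/-- A true `Σ₁` formula is true in all sufficiently large worlds. -/
theorem sigma_one_eventually {φ : LSet.BoundedFormula α n} (hφ : IsSigma 1 n φ)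
    {β : Ordinal.{u}} {s : α ⊕ Fin n → ZFSet.{u}} (hs : ∀ i, s i ∈ (V_ β : Set ZFSet.{u}))
    (h : Sat Set.univ φ s) : ∃ γ, ∀ τ ≥ γ, Sat (V_ τ : Set ZFSet.{u}) φ s := by
  induction hφ generalizing β with
  | base hφ =>
    exact ⟨β, fun τ hτ => (IsDelta0.absolute hφ transClass_univ (transClass_vonNeumann τ)
      (fun _ => trivial) fun i => vonNeumann_subset_coe hτ (hs i)).1 h⟩
  | ex _ ih =>
    simp only [sat_ex] at h ⊢
    obtain ⟨x, -, h⟩ := h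
    obtain ⟨ξ, hξ⟩ := ZFSet.exists_mem_vonNeumann x
    obtain ⟨γ, hγ⟩ := ih (assign_mem (A := (V_ (max β ξ) : Set ZFSet.{u}))
      (fun i => vonNeumann_subset_coe (le_max_left _ _) (hs i))
      (vonNeumann_subset_coe (le_max_right _ _) hξ)) h
    exact ⟨max γ ξ, fun τ hτ => ⟨x, vonNeumann_subset_coe (le_trans (le_max_right _ _) hτ) hξ,
      hγ τ (le_trans (le_max_left _ _) hτ)⟩⟩

/-! ### Relativization -/

/-- The action of a change of variables in the scope of a new quantifier. -/
def upMap (f : α ⊕ Fin n → β ⊕ Fin N) : α ⊕ Fin (n + 1) → β ⊕ Fin (N + 1) :=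
  assign (up ∘ f) top

/-- The result of bounding all quantifiers by the variable `w` and renaming the variables. -/
def relativize : ∀ {n N : ℕ}, (β ⊕ Fin N) → (α ⊕ Fin n → β ⊕ Fin N) →
    LSet.BoundedFormula α n → LSet.BoundedFormula β N
  | _, _, _, _, .falsum => .falsum
  | _, _, _, f, .equal t₁ t₂ => .equal (.var (f (termVar t₁))) (.var (f (termVar t₂)))
  | _, _, _, f, .rel R ts => .rel R fun i => .var (f (termVar (ts i)))
  | _, _, w, f, .imp φ ψ => .imp (relativize w f φ) (relativize w f ψ)
  | _, _, w, f, .all φ => boundedAll w (relativize (up w) (upMap f) φ)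

theorem isDelta0_relativize (w : β ⊕ Fin N) (f : α ⊕ Fin n → β ⊕ Fin N)
    (φ : LSet.BoundedFormula α n) : IsDelta0 (relativize w f φ) := by
  induction φ generalizing N with
  | falsum => exact .falsum
  | equal => exact .equal _ _
  | rel => exact .rel _ _
  | imp _ _ h₁ h₂ => exact .imp (h₁ _ _) (h₂ _ _)
  | all _ h => exact .ball _ (h _ _)

theorem assign_comp_upMap (s : β ⊕ Fin N → ZFSet.{u}) (f : α ⊕ Fin n → β ⊕ Fin N) (x : ZFSet.{u}) :
    assign s x ∘ upMap f = assign (s ∘ f) x := by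
  rw [upMap, comp_assign, ← Function.comp_assoc]
  simp

theorem sat_relativize {A : Set ZFSet.{u}} (hA : TransClass A) (w : β ⊕ Fin N)
    (f : α ⊕ Fin n → β ⊕ Fin N) (φ : LSet.BoundedFormula α n) (s : β ⊕ Fin N → ZFSet.{u})
    (hw : s w ∈ A) :
    Sat A (relativize w f φ) s ↔ Sat (s w : Set ZFSet.{u}) φ (s ∘ f) := by
  induction φ generalizing N with
  | falsum => rfl
  | equal => rfl
  | rel => rfl
  | imp _ _ h₁ h₂ => simp only [relativize, sat_imp, h₁ w f s hw, h₂ w f s hw]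
  | all φ h =>
    rw [relativize, hA.sat_boundedAll hw, sat_all]
    refine forall₂_congr fun x hx => ?_
    rw [h _ _ _ (by simpa using hw), assign_comp_upMap, assign_up]

end Satisfaction

/-! ### Levels of the cumulative hierarchy -/

section Levels

variable {α β : Type*} {n N : ℕ}

/-- `x ⊆ y`. -/
def subsetFormula (x y : α ⊕ Fin n) : LSet.BoundedFormula α n :=
  boundedAll x (memFormula top (up y))

theorem isDelta0_subset (x y : α ⊕ Fin n) : IsDelta0 (subsetFormula x y) :=
  .ball _ (isDelta0_mem _ _)

theorem sat_subset {A : Set ZFSet.{u}} (hA : TransClass A) {s : α ⊕ Fin n → ZFSet.{u}}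
    {x y : α ⊕ Fin n} (hx : s x ∈ A) : Sat A (subsetFormula x y) s ↔ s x ⊆ s y := by
  rw [subsetFormula, hA.sat_boundedAll hx]
  simp [ZFSet.subset_def]

/-- `h` is a history ending with `w`, as far as the potential element `x` of its members is
concerned. -/
def historyFormula (w h x : α ⊕ Fin n) : LSet.BoundedFormula α n :=
  memFormula w h ⊓ boundedAll h ((memFormula (up x) top).iff
    (boundedEx (up h) (memFormula top (up top) ⊓ subsetFormula (up (up x)) top)))

theorem isDelta0_history (w h x : α ⊕ Fin n) : IsDelta0 (historyFormula w h x) :=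
  .inf (isDelta0_mem _ _) (.ball _ (.iff (isDelta0_mem _ _)
    (.bex _ (.inf (isDelta0_mem _ _) (isDelta0_subset _ _)))))

/-- With `x` universally quantified, the clause for `k` says that `k` is the union of the power sets
of the members of `h` lying in `k`, which is the recursion of the cumulative hierarchy. The variable
`x` stays free so that the matrix is `Δ₀`. -/
theorem sat_history {A : Set ZFSet.{u}} (hA : TransClass A) {s : α ⊕ Fin n → ZFSet.{u}}
    {w h x : α ⊕ Fin n} (hh : s h ∈ A) (hx : s x ∈ A) :
    Sat A (historyFormula w h x) s ↔
      s w ∈ s h ∧ ∀ k ∈ s h, (s x ∈ k ↔ ∃ c ∈ s h, c ∈ k ∧ s x ⊆ c) := by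
  rw [historyFormula, sat_inf, hA.sat_boundedAll hh]
  refine and_congr (by simp) (forall₂_congr fun k hk => ?_)
  rw [sat_iff, hA.sat_boundedEx (by simpa using hh)]
  refine iff_congr (by simp) (exists_congr fun c => and_congr (by simp) ?_)
  rw [sat_inf, sat_subset hA (by simpa using hx)]
  simp

/-- The members of a history are levels of the cumulative hierarchy. -/
theorem eq_vonNeumann_of_history {H : ZFSet.{u}}
    (hH : ∀ k ∈ H, ∀ x, x ∈ k ↔ ∃ c ∈ H, c ∈ k ∧ x ⊆ c) (k : ZFSet.{u}) (hk : k ∈ H) :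
    k = V_ k.rank := by
  induction k using ZFSet.inductionOn with
  | h k ih =>
    ext x
    rw [ZFSet.mem_vonNeumann]
    refine ⟨ZFSet.rank_lt_of_mem, fun hx => ?_⟩
    -- Some `y ∈ k` has at least the rank of `x`. The member `c` of the history that includes `y` is
    -- a level by induction, so it also includes `x`.
    obtain ⟨y, hy, hxy⟩ := ZFSet.lt_rank_iff.1 hx
    obtain ⟨c, hc, hck, hyc⟩ := (hH k hk y).1 hy
    refine (hH k hk x).2 ⟨c, hc, hck, ?_⟩
    rw [ih c hck hc, ZFSet.subset_vonNeumann]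
    exact hxy.trans (ZFSet.rank_mono hyc)

/-- The history of the level `V_λ`. -/
theorem exists_history (l : Ordinal.{u}) : ∃ H ∈ (V_ (l + 2) : Set ZFSet.{u}), V_ l ∈ H ∧
    ∀ k ∈ H, ∀ x, x ∈ k ↔ ∃ c ∈ H, c ∈ k ∧ x ⊆ c := by
  -- The history is `{V_b | b ≤ l}`. It is a subset of `V_ (l + 1)`, hence the `l + 2`.
  have hmem : ∀ y, y ∈ ZFSet.sep (fun y => y = V_ y.rank) (V_ (l + 1)) ↔ ∃ b ≤ l, y = V_ b := by
    intro y
    rw [ZFSet.mem_sep, ZFSet.mem_vonNeumann, Order.lt_add_one_iff]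
    constructor
    · rintro ⟨h, h'⟩
      exact ⟨_, h, h'⟩
    · rintro ⟨b, hb, rfl⟩
      simpa using hb
  refine ⟨ZFSet.sep (fun y => y = V_ y.rank) (V_ (l + 1)), ?_, (hmem _).2 ⟨l, le_rfl, rfl⟩, ?_⟩
  · have h2 : l + 2 = l + 1 + 1 := by rw [add_assoc, one_add_one_eq_two]
    change _ ∈ V_ (l + 2)
    rw [h2, ZFSet.vonNeumann_add_one, ZFSet.mem_powerset]
    exact ZFSet.sep_subset
  · intro k hk x
    obtain ⟨b, hb, rfl⟩ := (hmem k).1 hk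
    rw [ZFSet.mem_vonNeumann]
    constructor
    · intro hx
      exact ⟨V_ x.rank, (hmem _).2 ⟨_, hx.le.trans hb, rfl⟩, by simpa using hx,
        ZFSet.subset_vonNeumann_self x⟩
    · rintro ⟨c, -, hcb, hxc⟩
      exact (ZFSet.rank_mono hxc).trans_lt (ZFSet.mem_vonNeumann.1 hcb)

/-- `w` is a level of the cumulative hierarchy. -/
def levelFormula (w : α ⊕ Fin n) : LSet.BoundedFormula α n :=
  (historyFormula (up (up w)) (up top) top).all.ex

theorem eq_vonNeumann_of_sat_level {γ : Ordinal.{u}} {s : α ⊕ Fin n → ZFSet.{u}}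
    {w : α ⊕ Fin n}
    (h : Sat (V_ γ : Set ZFSet.{u}) (levelFormula w) s) : s w = V_ (s w).rank := by
  simp only [levelFormula, sat_ex, sat_all] at h
  obtain ⟨H, hH, h⟩ := h
  have h' : ∀ x ∈ (V_ γ : Set ZFSet.{u}), s w ∈ H ∧ ∀ k ∈ H, (x ∈ k ↔ ∃ c ∈ H, c ∈ k ∧ x ⊆ c) := by
    intro x hx
    have := h x hx
    rw [sat_history (transClass_vonNeumann γ) (by simpa using hH) (by simpa using hx)] at this
    simpa using this
  -- `V_γ` is closed under subsets, so letting `x` range over `V_γ` only misses no candidate.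
  have hsub : ∀ k ∈ H, ∀ x, x ⊆ k → x ∈ (V_ γ : Set ZFSet.{u}) := fun k hk x hx =>
    ZFSet.mem_vonNeumann_of_subset hx (ZFSet.isTransitive_vonNeumann γ _ hH hk)
  refine eq_vonNeumann_of_history (H := H) (fun k hk x => ?_) _ (h' H hH).1
  constructor
  · intro hx
    exact ((h' x (transClass_vonNeumann γ _ (hsub k hk k fun _ h => h) _ hx)).2 k hk).1 hx
  · rintro ⟨c, hc, hck, hxc⟩
    exact ((h' x (hsub c hc x hxc)).2 k hk).2 ⟨c, hc, hck, hxc⟩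

theorem sat_level_of_eq {γ l : Ordinal.{u}} (hl : l + 2 ≤ γ) {s : α ⊕ Fin n → ZFSet.{u}}
    {w : α ⊕ Fin n} (hw : s w = V_ l) : Sat (V_ γ : Set ZFSet.{u}) (levelFormula w) s := by
  obtain ⟨H, hH, hlH, h⟩ := exists_history l
  have hHγ := vonNeumann_subset_coe hl hH
  simp only [levelFormula, sat_ex, sat_all]
  refine ⟨H, hHγ, fun x hx => ?_⟩
  rw [sat_history (transClass_vonNeumann γ) (by simpa using hHγ) (by simpa using hx)]
  simp only [assign_up, assign_top, hw]
  exact ⟨hlH, fun k hk => h k hk x⟩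

/-! ### Eventual truth -/

/-- For all levels `w` that contain `b`, the formula `φ` holds in `w`. -/
def allLevels (b : β ⊕ Fin N) (f : α ⊕ Fin n → β ⊕ Fin N) (φ : LSet.BoundedFormula α n) :
    LSet.BoundedFormula β N :=
  ((historyFormula (up (up top)) (up top) top ⊓ memFormula (up (up (up b))) (up (up top))).imp
    (relativize (up (up top)) (up ∘ up ∘ up ∘ f) φ)).ex.all.all

/-- The quantifier over `x` in the premise "`H` is a history" is universal, so in front of the
implication it becomes existential: the prefix is `∀ W ∀ H ∃ x` over a `Δ₀` matrix. -/
theorem isPi_allLevels (b : β ⊕ Fin N) (f : α ⊕ Fin n → β ⊕ Fin N) (φ : LSet.BoundedFormula α n) :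
    IsPi 2 N (allLevels b f φ) :=
  .all (.all (.base (.ex (.base (.imp (.inf (isDelta0_history _ _ _) (isDelta0_mem _ _))
    (isDelta0_relativize _ _ _))))))

theorem sat_allLevels_transClass {A : Set ZFSet.{u}} (hA : TransClass A) (b : β ⊕ Fin N)
    (f : α ⊕ Fin n → β ⊕ Fin N) (φ : LSet.BoundedFormula α n) (s : β ⊕ Fin N → ZFSet.{u}) :
    Sat A (allLevels b f φ) s ↔ ∀ W ∈ A, ∀ H ∈ A, ∃ x ∈ A,
      (W ∈ H ∧ ∀ k ∈ H, (x ∈ k ↔ ∃ c ∈ H, c ∈ k ∧ x ⊆ c)) ∧ s b ∈ W →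
        Sat (W : Set ZFSet.{u}) φ (s ∘ f) := by
  simp only [allLevels, sat_all, sat_ex]
  refine forall₂_congr fun W hW => forall₂_congr fun H hH => exists_congr fun x =>
    and_congr_right fun hx => ?_
  rw [sat_imp, sat_inf, sat_history hA (by simpa using hH) (by simpa using hx),
    sat_relativize hA _ _ _ _ (by simpa using hW)]
  simp only [← Function.comp_assoc, assign_comp_up]
  simp

theorem sat_allLevels (b : β ⊕ Fin N) (f : α ⊕ Fin n → β ⊕ Fin N) (φ : LSet.BoundedFormula α n)
    (s : β ⊕ Fin N → ZFSet.{u}) :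
    Sat Set.univ (allLevels b f φ) s ↔
      ∀ γ, s b ∈ V_ γ → Sat (V_ γ : Set ZFSet.{u}) φ (s ∘ f) := by
  simp only [sat_allLevels_transClass transClass_univ, Set.mem_univ, true_and, forall_true_left]
  constructor
  · intro h γ hb
    obtain ⟨H, -, hγ, hH⟩ := exists_history γ
    obtain ⟨x, hx⟩ := h (V_ γ) H
    exact hx ⟨⟨hγ, fun k hk => hH k hk x⟩, hb⟩
  · intro h W H
    -- If no `x` works, the premise holds for every `x`, so `H` is a genuine history and `W` a
    -- level; `∅` is an arbitrary instance.
    by_contra! hc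
    have hW : W = V_ W.rank :=
      eq_vonNeumann_of_history (fun k hk x => (hc x).1.1.2 k hk) W (hc ∅).1.1.1
    apply (hc ∅).2
    rw [hW]
    exact h _ (hW ▸ (hc ∅).1.2)

/-- `SigmaCorrect` speaks of finitely many variables, whereas assertions with parameters use all of
`World δ` as variables. The reduction is the same for all worlds. -/
theorem exists_finite_parameters (φ : LSet.Formula α) : ∃ (m : ℕ) (g : Fin m → α)
    (ψ : LSet.Formula (Fin m)), ∀ (δ : Ordinal.{u}) (v : α → World δ),
      φ.Realize v ↔ ψ.Realize (v ∘ g) := by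
  classical
  let e := Fintype.equivFin φ.freeVarFinset
  refine ⟨_, fun i => (e.symm i).1, BoundedFormula.restrictFreeVar φ e, fun δ v => ?_⟩
  rw [Formula.Realize, Formula.Realize,
    BoundedFormula.realize_restrictFreeVar (φ := φ) (f := e) (v' := v)]
  simp

/-- Truth of a formula in the world `V_γ`, for arbitrary sets as values of the variables. -/
def Holds (φ : LSet.Formula α) (s : α → ZFSet.{u}) (γ : Ordinal.{u}) : Prop :=
  Sat (V_ γ : Set ZFSet.{u}) φ (Sum.elim s Fin.elim0)

theorem elim_coe {δ : Ordinal.{u}} (v : α → World δ) (xs : Fin 0 → World δ) :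
    (fun i => (Sum.elim v xs i).1) = Sum.elim (fun i => (v i).1) Fin.elim0 := by
  funext i
  rcases i with i | i
  · rfl
  · exact i.elim0

theorem holds_iff_realize {δ : Ordinal.{u}} (φ : LSet.Formula α) (v : α → World δ) :
    Holds φ (fun i => (v i).1) δ ↔ φ.Realize v := by
  rw [Formula.Realize, realize_world, elim_coe]
  rfl

theorem formula_realize_zfset (φ : LSet.Formula α) (v : α → ZFSet.{u}) :
    φ.Realize v ↔ Sat Set.univ φ (Sum.elim v Fin.elim0) := by
  rw [Formula.Realize, realize_zfset]
  exact Iff.of_eq (congrArg (fun xs => Sat Set.univ φ (Sum.elim v xs)) (Subsingleton.elim _ _))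

/-- At a `Σ₃`-correct ordinal, eventual truth of an assertion implies its truth from then on. -/
theorem SigmaCorrect.holds_of_eventually {δ : Ordinal.{u}} (hδ : SigmaCorrect 3 δ)
    (φ : LSet.Formula α) (s : α → ZFSet.{u}) (hs : ∀ i, s i ∈ V_ δ)
    (h : ∃ β, ∀ γ ≥ β, Holds φ s γ) : ∀ γ ≥ δ, Holds φ s γ := by
  obtain ⟨m, g, ψ, hψ⟩ := exists_finite_parameters.{u} φ
  have hψ' : ∀ γ ≥ δ, (Holds φ s γ ↔ Holds ψ (s ∘ g) γ) := fun γ hγ =>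
    (holds_iff_realize φ (fun i => (⟨s i, vonNeumann_subset_coe hγ (hs i)⟩ : World γ))).trans
      ((hψ γ _).trans (holds_iff_realize ψ _).symm)
  obtain ⟨β, hβ⟩ := h
  -- The `Σ₃` statement of eventual truth. A level that contains `V_ (max β δ)` has index above both
  -- ordinals.
  have hE : Sat Set.univ (allLevels (n := 0) top up ψ).ex (Sum.elim (s ∘ g) Fin.elim0) := by
    rw [sat_ex]
    refine ⟨V_ (max β δ), trivial, ?_⟩
    rw [sat_allLevels]
    intro γ hγ
    rw [assign_top, ZFSet.vonNeumann_mem_vonNeumann_iff] at hγ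
    rw [assign_comp_up]
    exact (hψ' γ ((le_max_right _ _).trans hγ.le)).1 (hβ γ ((le_max_left _ _).trans hγ.le))
  let v : Fin m → World δ := fun i => ⟨s (g i), hs _⟩
  -- First use of correctness: a witness `W` is found inside `V_δ`.
  have hE' := (hδ m _ (.ex (.base (isPi_allLevels top up ψ))) v).2
    ((formula_realize_zfset _ _).2 hE)
  rw [← holds_iff_realize, Holds, sat_ex] at hE'
  obtain ⟨W, hW, hW'⟩ := hE'
  let v' : Fin (m + 1) → World δ := Fin.snoc (α := fun _ => World δ) v ⟨W, hW⟩
  let f : Fin m ⊕ Fin 0 → Fin (m + 1) ⊕ Fin 0 := Sum.map Fin.castSucc id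
  have hf : Sum.elim (fun i => (v' i).1) Fin.elim0 ∘ f = Sum.elim (s ∘ g) Fin.elim0 := by
    funext i
    rcases i with i | i
    · exact congrArg Subtype.val (Fin.snoc_castSucc (α := fun _ => World δ) _ _ i)
    · exact i.elim0
  have hb : (Sum.elim (fun i => (v' i).1) Fin.elim0 : Fin (m + 1) ⊕ Fin 0 → ZFSet.{u})
      (Sum.inl (Fin.last m)) = W :=
    congrArg Subtype.val (Fin.snoc_last (α := fun _ => World δ) _ _)
  rw [sat_allLevels_transClass (transClass_vonNeumann δ), assign_top, assign_comp_up] at hW'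
  -- Second use, upwards: the `Π₂` statement about `W` counts as `Σ₃` with an empty block, so it is
  -- true in `V`. As `W ∈ V_δ`, it covers all levels from `δ` on.
  have hF := (hδ (m + 1) (allLevels (Sum.inl (Fin.last m)) f ψ)
    (.base (isPi_allLevels _ _ _)) v').1 (by
      rw [← holds_iff_realize, Holds, sat_allLevels_transClass (transClass_vonNeumann δ), hb, hf]
      exact hW')
  rw [formula_realize_zfset, sat_allLevels, hb, hf] at hF
  intro γ hγ
  rw [hψ' γ hγ]
  exact hF γ (vonNeumann_subset_coe hγ hW)

end Levels

/-! ### Completeness of S5 with respect to finite universal models -/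

section S5

open ModalFormula

/-- Truth of a modal formula at `w` in the universal model with the set `S` of worlds, a world being
given by the propositional variables that are true there. -/
def EvalS5 (S : Set (ℕ → Prop)) : ModalFormula → (ℕ → Prop) → Prop
  | .var i, w => w i
  | .bot, _ => False
  | .imp φ ψ, w => EvalS5 S φ w → EvalS5 S ψ w
  | .box φ, _ => ∀ w ∈ S, EvalS5 S φ w

/-- One counterexample for each false boxed subformula suffices. Allowing every `S'` between `F` and
`S` lets the finite sets of two subformulas be united. -/
theorem exists_finite_evalS5 (S : Set (ℕ → Prop)) (φ : ModalFormula) :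
    ∃ F ⊆ S, F.Finite ∧ ∀ S', F ⊆ S' → S' ⊆ S → ∀ w, EvalS5 S' φ w ↔ EvalS5 S φ w := by
  induction φ with
  | var i => exact ⟨∅, by simp, by simp, fun _ _ _ _ => Iff.rfl⟩
  | bot => exact ⟨∅, by simp, by simp, fun _ _ _ _ => Iff.rfl⟩
  | imp φ ψ h₁ h₂ =>
    obtain ⟨F₁, hF₁, hfin₁, h₁⟩ := h₁
    obtain ⟨F₂, hF₂, hfin₂, h₂⟩ := h₂
    refine ⟨F₁ ∪ F₂, Set.union_subset hF₁ hF₂, hfin₁.union hfin₂, fun S' hF hS' w => ?_⟩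
    rw [Set.union_subset_iff] at hF
    simp only [EvalS5, h₁ S' hF.1 hS', h₂ S' hF.2 hS']
  | box φ h =>
    obtain ⟨F, hF, hfin, h⟩ := h
    by_cases hφ : ∀ w ∈ S, EvalS5 S φ w
    · refine ⟨F, hF, hfin, fun S' hFS' hS' w => ?_⟩
      simp only [EvalS5, h S' hFS' hS']
      exact iff_of_true (fun w hw => hφ w (hS' hw)) hφ
    · push Not at hφ
      obtain ⟨w₀, hw₀, hφ⟩ := hφ
      refine ⟨insert w₀ F, Set.insert_subset hw₀ hF, hfin.insert w₀, fun S' hFS' hS' w => ?_⟩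
      rw [Set.insert_subset_iff] at hFS'
      simp only [EvalS5, h S' hFS'.2 hS']
      exact iff_of_false (fun H => hφ (H w₀ hFS'.1)) (fun H => hφ (H w₀ hw₀))

/-- Derivability from a set of premises in S5, without necessitation of the premises. -/
inductive Derives (Γ : Set ModalFormula) : ModalFormula → Prop
  | premise {φ : ModalFormula} : φ ∈ Γ → Derives Γ φ
  | thm {φ : ModalFormula} : S5Provable φ → Derives Γ φ
  | mp {φ ψ : ModalFormula} : Derives Γ (φ.imp ψ) → Derives Γ φ → Derives Γ ψ

theorem Derives.deduction {Γ : Set ModalFormula} {χ φ : ModalFormula}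
    (h : Derives (insert χ Γ) φ) : Derives Γ (χ.imp φ) := by
  induction h with
  | @premise φ h =>
    rcases h with rfl | h
    · exact .thm (.taut fun v => id)
    · exact .mp (.thm (.taut fun v (h : φ.propEval v) _ => h)) (.premise h)
  | @thm φ h => exact .mp (.thm (.taut fun v (h : φ.propEval v) _ => h)) (.thm h)
  | @mp φ ψ _ _ h₁ h₂ =>
    exact .mp (.mp (.thm (.taut (φ := (χ.imp (φ.imp ψ)).imp ((χ.imp φ).imp (χ.imp ψ)))
      fun v h₁ h₂ h => h₁ h (h₂ h))) h₁) h₂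

theorem Derives.mono {Γ Δ : Set ModalFormula} (hΓ : Γ ⊆ Δ) {φ : ModalFormula}
    (h : Derives Γ φ) : Derives Δ φ := by
  induction h with
  | premise h => exact .premise (hΓ h)
  | thm h => exact .thm h
  | mp _ _ h₁ h₂ => exact .mp h₁ h₂

theorem Derives.of_sUnion {c : Set (Set ModalFormula)} (hc : IsChain (· ⊆ ·) c)
    (hne : c.Nonempty) {φ : ModalFormula} (h : Derives (⋃₀ c) φ) : ∃ Γ ∈ c, Derives Γ φ := by
  induction h with
  | premise h =>
    obtain ⟨Γ, hΓ, h⟩ := h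
    exact ⟨Γ, hΓ, .premise h⟩
  | thm h =>
    obtain ⟨Γ, hΓ⟩ := hne
    exact ⟨Γ, hΓ, .thm h⟩
  | mp _ _ h₁ h₂ =>
    obtain ⟨Γ₁, hΓ₁, h₁⟩ := h₁
    obtain ⟨Γ₂, hΓ₂, h₂⟩ := h₂
    rcases hc.total hΓ₁ hΓ₂ with h | h
    · exact ⟨Γ₂, hΓ₂, .mp (h₁.mono h) h₂⟩
    · exact ⟨Γ₁, hΓ₁, .mp h₁ (h₂.mono h)⟩

/-- A maximal consistent set of modal formulas. -/
def IsMaxConsistent (Γ : Set ModalFormula) : Prop := Maximal (fun Γ => ¬ Derives Γ bot) Γ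

theorem exists_isMaxConsistent {Γ : Set ModalFormula} (h : ¬ Derives Γ bot) :
    ∃ Δ, Γ ⊆ Δ ∧ IsMaxConsistent Δ :=
  zorn_subset_nonempty {Γ | ¬ Derives Γ bot} (fun c hc hchain hne => ⟨⋃₀ c, fun h => by
    obtain ⟨Γ, hΓ, h⟩ := h.of_sUnion hchain hne
    exact hc hΓ h, fun _ => Set.subset_sUnion_of_mem⟩) Γ h

namespace IsMaxConsistent

variable {Γ : Set ModalFormula} {φ ψ : ModalFormula}

theorem mem_of_derives (hΓ : IsMaxConsistent Γ) (h : Derives Γ φ) : φ ∈ Γ := by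
  by_contra hφ
  have : Derives (insert φ Γ) bot := by
    by_contra hc
    exact hφ (hΓ.2 hc (Set.subset_insert φ Γ) (Set.mem_insert φ Γ))
  exact hΓ.1 (.mp this.deduction h)

theorem bot_notMem (hΓ : IsMaxConsistent Γ) : bot ∉ Γ := fun h => hΓ.1 (.premise h)

theorem neg_mem (hΓ : IsMaxConsistent Γ) (h : φ ∉ Γ) : φ.neg ∈ Γ := by
  by_contra hc
  have : Derives (insert φ Γ) bot := by
    by_contra hc
    exact h (hΓ.2 hc (Set.subset_insert φ Γ) (Set.mem_insert φ Γ))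
  exact hc (hΓ.mem_of_derives this.deduction)

theorem mem_of_provable (hΓ : IsMaxConsistent Γ) (h : S5Provable φ) : φ ∈ Γ :=
  hΓ.mem_of_derives (.thm h)

theorem mp (hΓ : IsMaxConsistent Γ) (h : φ.imp ψ ∈ Γ) (h' : φ ∈ Γ) : ψ ∈ Γ :=
  hΓ.mem_of_derives (.mp (.premise h) (.premise h'))

theorem imp_mem_iff (hΓ : IsMaxConsistent Γ) : φ.imp ψ ∈ Γ ↔ (φ ∈ Γ → ψ ∈ Γ) := by
  refine ⟨hΓ.mp, fun h => ?_⟩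
  by_cases hφ : φ ∈ Γ
  · exact hΓ.mp (hΓ.mem_of_provable (.taut fun v (h : ψ.propEval v) _ => h)) (h hφ)
  · exact hΓ.mp (hΓ.mem_of_provable (.taut (φ := φ.neg.imp (φ.imp ψ))
      fun v h h' => (h h').elim))
      (hΓ.neg_mem hφ)

theorem box_mem_of_derives (hΓ : IsMaxConsistent Γ) (h : Derives {χ | χ.box ∈ Γ} φ) :
    φ.box ∈ Γ := by
  induction h with
  | premise h => exact h
  | thm h => exact hΓ.mem_of_provable (.nec h)
  | mp _ _ h₁ h₂ => exact hΓ.mp (hΓ.mp (hΓ.mem_of_provable (.axiomK _ _)) h₁) h₂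

theorem exists_of_box_notMem (hΓ : IsMaxConsistent Γ) (h : φ.box ∉ Γ) :
    ∃ Δ, IsMaxConsistent Δ ∧ (∀ χ : ModalFormula, χ.box ∈ Γ → χ ∈ Δ) ∧ φ ∉ Δ := by
  have hcons : ¬ Derives (insert φ.neg {χ | χ.box ∈ Γ}) bot := by
    intro hd
    refine h (hΓ.box_mem_of_derives (.mp (.thm (.taut ?_)) hd.deduction))
    exact fun v (hv : (φ.propEval v → False) → False) => by_contra hv
  obtain ⟨Δ, hsub, hΔ⟩ := exists_isMaxConsistent hcons
  exact ⟨Δ, hΔ, fun χ hχ => hsub (Set.mem_insert_of_mem _ hχ),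
    fun hφ => hΔ.bot_notMem (hΔ.mp (hsub (Set.mem_insert _ _)) hφ)⟩

/-- Makes the part of the canonical model seen from `Γ` a universal model. If `□φ ∉ Γ`, then `◇□□φ →
□φ` forces `□¬□□φ ∈ Γ`, so `¬□□φ ∈ Δ`, which by axiom 4 excludes `□φ ∈ Δ`. -/
theorem box_mem_of_accessible (hΓ : IsMaxConsistent Γ) {Δ : Set ModalFormula}
    (hΔ : IsMaxConsistent Δ) (hΓΔ : ∀ χ : ModalFormula, χ.box ∈ Γ → χ ∈ Δ) : φ.box ∈ Δ ↔ φ.box ∈ Γ := by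
  refine ⟨fun h => ?_, fun h => hΓΔ _ (hΓ.mp (hΓ.mem_of_provable (.axiomFour φ)) h)⟩
  by_contra hc
  have hbox : φ.box.box.neg.box ∈ Γ := by
    by_contra hc'
    exact hc (hΓ.mp (hΓ.mem_of_provable (.axiomFive φ.box)) (hΓ.neg_mem hc'))
  exact hΔ.bot_notMem
    (hΔ.mp (hΓΔ _ hbox) (hΔ.mp (hΔ.mem_of_provable (.axiomFour φ)) h))

end IsMaxConsistent

/-- Completeness of S5. -/
theorem exists_not_evalS5 {φ : ModalFormula} (hφ : ¬ S5Provable φ) :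
    ∃ S : Set (ℕ → Prop), S.Finite ∧ ∃ w ∈ S, ¬ EvalS5 S φ w := by
  have hcons : ¬ Derives {φ.neg} bot := by
    intro hd
    rw [← insert_empty_eq] at hd
    have : ∀ ψ, Derives ∅ ψ → S5Provable ψ := by
      intro ψ h
      induction h with
      | premise h => exact h.elim
      | thm h => exact h
      | mp _ _ h₁ h₂ => exact .mp h₁ h₂
    exact hφ (.mp (.taut (φ := φ.neg.neg.imp φ) fun v hv => by_contra hv)
      (this _ hd.deduction))
  obtain ⟨Γ, hsub, hΓ⟩ := exists_isMaxConsistent hcons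
  let C : Set (Set ModalFormula) :=
    {Δ | IsMaxConsistent Δ ∧ ∀ χ : ModalFormula, χ.box ∈ Γ → χ ∈ Δ}
  -- Maximal consistent sets with the same variables become one world; the truth lemma shows that
  -- this loses nothing.
  let w : Set ModalFormula → ℕ → Prop := fun Δ i => ModalFormula.var i ∈ Δ
  have truth : ∀ ψ, ∀ Δ ∈ C, EvalS5 (w '' C) ψ (w Δ) ↔ ψ ∈ Δ := by
    intro ψ
    induction ψ with
    | var i => exact fun Δ _ => Iff.rfl
    | bot => exact fun Δ hΔ => iff_of_false id hΔ.1.bot_notMem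
    | imp ψ χ h₁ h₂ =>
      intro Δ hΔ
      rw [hΔ.1.imp_mem_iff, EvalS5, h₁ Δ hΔ, h₂ Δ hΔ]
    | box ψ h =>
      intro Δ hΔ
      rw [hΓ.box_mem_of_accessible hΔ.1 hΔ.2, EvalS5, Set.forall_mem_image]
      constructor
      · intro hall
        by_contra hc
        obtain ⟨Θ, hΘ, hacc, hψ⟩ := hΓ.exists_of_box_notMem hc
        exact hψ ((h Θ ⟨hΘ, hacc⟩).1 (hall ⟨hΘ, hacc⟩))
      · exact fun hbox Θ hΘ => (h Θ hΘ).2 (hΘ.2 ψ hbox)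
  have hΓC : Γ ∈ C := ⟨hΓ, fun χ h => hΓ.mp (hΓ.mem_of_provable (.axiomT χ)) h⟩
  obtain ⟨F, hF, hfin, h⟩ := exists_finite_evalS5 (w '' C) φ
  refine ⟨insert (w Γ) F, hfin.insert _, w Γ, Set.mem_insert _ _, ?_⟩
  rw [h _ (Set.subset_insert _ _) (Set.insert_subset ⟨Γ, hΓC, rfl⟩ hF), truth φ Γ hΓC]
  exact fun h => hΓ.bot_notMem (hΓ.mp (hsub rfl) h)

end S5

/-! ### Potentialist truth of modal formulas -/

section Forces

open ModalFormula

/-- Truth of a modal formula at an ordinal, the truth of the propositional variables being given. -/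
def Forces (val : ℕ → Ordinal.{u} → Prop) : ModalFormula → Ordinal.{u} → Prop
  | .var i, γ => val i γ
  | .bot, _ => False
  | .imp φ ψ, γ => Forces val φ γ → Forces val ψ γ
  | .box φ, γ => ∀ γ' ≥ γ, Forces val φ γ'

theorem realize_ofFormula {α : Type*} {n : ℕ} (φ : LSet.BoundedFormula α n) (δ : Ordinal.{u})
    (v : α → World δ) (xs : Fin n → World δ) :
    (PotFormula.ofFormula φ).Realize δ v xs ↔ φ.Realize v xs := by
  induction φ with
  | falsum => rfl
  | equal => rfl
  | rel => rfl
  | imp φ ψ h₁ h₂ => simp only [PotFormula.ofFormula, PotFormula.Realize, h₁, h₂,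
      BoundedFormula.Realize]
  | all φ h => simp only [PotFormula.ofFormula, PotFormula.Realize, h, BoundedFormula.Realize]

theorem realize_subst {α : Type*} (ψ : ℕ → LSet.Formula α) (φ : ModalFormula) (δ : Ordinal.{u})
    (v : α → World δ) (xs : Fin 0 → World δ) :
    (φ.subst fun i => PotFormula.ofFormula (ψ i)).Realize δ v xs ↔
      Forces (fun i => Holds (ψ i) fun a => (v a).1) φ δ := by
  induction φ generalizing δ with
  | var i =>
    rw [ModalFormula.subst, realize_ofFormula, Forces, holds_iff_realize, Formula.Realize,
      Subsingleton.elim xs default]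
  | bot => rfl
  | imp φ χ h₁ h₂ => simp only [ModalFormula.subst, PotFormula.Realize, h₁, h₂, Forces]
  | box φ h =>
    simp only [ModalFormula.subst, PotFormula.Realize, h, Forces]
    refine forall_congr' fun γ => ?_
    rw [ge_iff_le, ← ZFSet.vonNeumann_subset_vonNeumann_iff]
    rfl

theorem mem_validities {α : Type*} {δ : Ordinal.{u}} {v : α → World δ} {φ : ModalFormula} :
    φ ∈ validities δ v ↔
      ∀ ψ : ℕ → LSet.Formula α, Forces (fun i => Holds (ψ i) fun a => (v a).1) φ δ :=
  forall_congr' fun ψ => realize_subst ψ φ δ v _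

/-- If eventual truth of the assertions in question implies their truth from `δ` on, then S5 is
valid at all ordinals from `δ` on. -/
theorem forces_of_s5Provable {D : Set (Ordinal.{u} → Prop)} {δ : Ordinal.{u}}
    (hbot : (fun _ => False) ∈ D) (himp : ∀ P ∈ D, ∀ Q ∈ D, (fun γ => P γ → Q γ) ∈ D)
    (hD : ∀ P ∈ D, (∃ β, ∀ γ ≥ β, P γ) → ∀ γ ≥ δ, P γ) {val : ℕ → Ordinal.{u} → Prop}
    (hval : ∀ i, val i ∈ D) {φ : ModalFormula} (hφ : S5Provable φ) :
    ∀ γ ≥ δ, Forces val φ γ := by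
  -- From `δ` on, a boxed formula is constantly true or constantly false, according to whether its
  -- argument is eventually true, so modal formulas reduce to members of `D`.
  have elim : ∀ φ, ∃ P ∈ D, ∀ γ ≥ δ, (Forces val φ γ ↔ P γ) := by
    intro φ
    induction φ with
    | var i => exact ⟨val i, hval i, fun _ _ => Iff.rfl⟩
    | bot => exact ⟨_, hbot, fun _ _ => Iff.rfl⟩
    | imp φ ψ h₁ h₂ =>
      obtain ⟨P, hP, h₁⟩ := h₁
      obtain ⟨Q, hQ, h₂⟩ := h₂
      exact ⟨_, himp P hP Q hQ, fun γ hγ => by rw [Forces, h₁ γ hγ, h₂ γ hγ]⟩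
    | box φ h =>
      obtain ⟨P, hP, h⟩ := h
      by_cases hev : ∃ β, ∀ γ ≥ β, P γ
      · refine ⟨_, himp _ hbot _ hbot, fun γ hγ => iff_of_true (fun γ' hγ' => ?_) id⟩
        exact (h γ' (hγ.trans hγ')).2 (hD P hP hev γ' (hγ.trans hγ'))
      · refine ⟨_, hbot, fun γ hγ => iff_of_false (fun H => hev ⟨γ, fun γ' hγ' => ?_⟩) id⟩
        exact (h γ' (le_trans hγ hγ')).1 (H γ' hγ')
  induction hφ with
  | @taut φ h =>
    intro γ _
    have key : ∀ ψ : ModalFormula, ψ.propEval (fun χ => Forces val χ γ) ↔ Forces val ψ γ := by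
      intro ψ
      induction ψ with
      | var => rfl
      | bot => rfl
      | imp ψ χ h₁ h₂ => rw [ModalFormula.propEval, h₁, h₂, Forces]
      | box => rfl
    exact (key φ).1 (h _)
  | axiomK φ ψ => exact fun γ _ h h' γ' hγ' => h γ' hγ' (h' γ' hγ')
  | axiomT φ => exact fun γ _ h => h γ le_rfl
  | axiomFour φ => exact fun γ _ h γ' hγ' γ'' hγ'' => h γ'' (le_trans hγ' hγ'')
  -- The only axiom that needs `hD`.
  | axiomFive φ =>
    intro γ hγ h
    by_contra hc
    refine h fun γ' hγ' h' => hc ?_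
    obtain ⟨P, hP, hφ⟩ := elim φ
    refine (hφ γ hγ).2 (hD P hP ⟨γ', fun γ'' hγ'' => ?_⟩ γ hγ)
    exact (hφ γ'' (le_trans hγ (le_trans hγ' hγ''))).1 (h' γ'' hγ'')
  | mp _ _ h₁ h₂ => exact fun γ hγ => h₁ γ hγ (h₂ γ hγ)
  | nec _ h => exact fun γ hγ γ' hγ' => h γ' (le_trans hγ hγ')

theorem SigmaCorrect.s5_subset_validities {α : Type*} {δ : Ordinal.{u}} (hδ : SigmaCorrect 3 δ)
    (v : α → World δ) : S5 ⊆ validities δ v := by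
  intro φ hφ
  rw [mem_validities]
  intro ψ
  refine forces_of_s5Provable (D := {P | ∃ χ : LSet.Formula α, P = Holds χ fun a => (v a).1})
    ⟨⊥, rfl⟩ ?_ ?_ (fun i => ⟨ψ i, rfl⟩) hφ δ le_rfl
  · rintro _ ⟨χ, rfl⟩ _ ⟨χ', rfl⟩
    exact ⟨χ.imp χ', rfl⟩
  · rintro _ ⟨χ, rfl⟩
    exact hδ.holds_of_eventually χ _ fun a => (v a).2

/-- If the worlds of a universal model are assigned to the ordinals in such a way that each of them
is assigned to unboundedly many ordinals, then truth in the model agrees with truth at the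
ordinals. -/
theorem forces_iff_evalS5 {S : Set (ℕ → Prop)} {w : Ordinal.{u} → ℕ → Prop}
    (hw : ∀ γ, w γ ∈ S) (hS : ∀ x ∈ S, ∀ γ, ∃ γ' ≥ γ, w γ' = x) (φ : ModalFormula)
    (γ : Ordinal.{u}) : Forces (fun i γ => w γ i) φ γ ↔ EvalS5 S φ (w γ) := by
  induction φ generalizing γ with
  | var => rfl
  | bot => rfl
  | imp φ ψ h₁ h₂ => rw [Forces, h₁, h₂, EvalS5]
  | box φ h =>
    simp only [Forces, h, EvalS5]
    constructor
    · intro H x hx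
      obtain ⟨γ', hγ', rfl⟩ := hS x hx γ
      exact H γ' hγ'
    · exact fun H γ' _ => H _ (hw γ')

end Forces

/-! ### Control statements, and the upper bound S5 for the validities -/

section Control

variable {α : Type*} {n : ℕ}

/-- In the world `V_γ`: the rank of `x` plus `j` is at least `γ`. -/
def rankFormula : ∀ {n : ℕ}, ℕ → (α ⊕ Fin n) → LSet.BoundedFormula α n
  | _, 0, _ => ⊥
  | _, j + 1, x => ((memFormula (up x) top).imp (rankFormula j top)).all

theorem add_natCast_succ (a : Ordinal.{u}) (j : ℕ) :
    a + ((j + 1 : ℕ) : Ordinal.{u}) = a + 1 + j := by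
  rw [add_comm j 1, Nat.cast_add, Nat.cast_one, add_assoc]

theorem sat_rankFormula (j : ℕ) (x : α ⊕ Fin n) (s : α ⊕ Fin n → ZFSet.{u}) {γ : Ordinal.{u}}
    (hx : s x ∈ V_ γ) :
    Sat (V_ γ : Set ZFSet.{u}) (rankFormula j x) s ↔ γ ≤ (s x).rank + j := by
  induction j generalizing n with
  | zero => simpa [rankFormula] using ZFSet.mem_vonNeumann.1 hx
  | succ j ih =>
    rw [rankFormula, sat_all]
    have h : ∀ y ∈ V_ γ, Sat (V_ γ : Set ZFSet.{u}) (rankFormula j top) (assign s y) ↔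
        γ ≤ y.rank + j := fun y hy => by rw [ih top _ (by simpa using hy), assign_top]
    constructor
    · intro H
      by_contra! hc
      have hj : (s x).rank + 1 + j < γ := by rwa [← add_natCast_succ]
      -- The singleton has the least rank possible for a set containing `s x`.
      have hy : ({s x} : ZFSet.{u}) ∈ V_ γ := by
        rw [ZFSet.mem_vonNeumann, ZFSet.rank_singleton]
        exact (le_add_of_nonneg_right zero_le).trans_lt hj
      have := (h _ hy).1 (H _ hy (by simp))
      rw [ZFSet.rank_singleton] at this
      exact this.not_gt hj
    · intro H y hy hxy
      refine (h y hy).2 (H.trans ?_)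
      rw [sat_mem, assign_up, assign_top] at hxy
      have := Order.add_one_le_of_lt (ZFSet.rank_lt_of_mem hxy)
      calc (s x).rank + ((j + 1 : ℕ) : Ordinal.{u}) = (s x).rank + 1 + j := by
            rw [add_natCast_succ]
        _ ≤ _ := by gcongr

/-- In the world `V_γ`: the ordinal `γ` is a `j`-fold successor. -/
def successorFormula (α : Type*) : ℕ → LSet.Formula α
  | 0 => ∼ ⊥
  | j + 1 => (rankFormula (j + 1) top ⊓ ∼ (rankFormula j top)).ex

/-- The two rank conditions pin `γ` down: `x.rank + j < γ ≤ x.rank + j + 1`. -/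
theorem holds_successorFormula (j : ℕ) (s : α → ZFSet.{u}) (γ : Ordinal.{u}) :
    Holds (successorFormula α j) s γ ↔ ∃ ρ, γ = ρ + j := by
  cases j with
  | zero => exact iff_of_true id ⟨γ, by simp⟩
  | succ j =>
    rw [Holds, successorFormula, sat_ex]
    constructor
    · rintro ⟨x, hx, h⟩
      rw [sat_inf, sat_not, sat_rankFormula _ _ _ (by rwa [assign_top]),
        sat_rankFormula _ _ _ (by rwa [assign_top]), assign_top, not_le] at h
      refine ⟨x.rank, h.1.antisymm ?_⟩
      rw [Nat.cast_add, Nat.cast_one, ← add_assoc]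
      exact Order.add_one_le_of_lt h.2
    · rintro ⟨ρ, rfl⟩
      have hρ : V_ ρ ∈ V_ (ρ + ((j + 1 : ℕ) : Ordinal.{u})) := by
        rw [ZFSet.vonNeumann_mem_vonNeumann_iff, Nat.cast_add, Nat.cast_one, ← add_assoc,
          Order.lt_add_one_iff]
        exact le_add_of_nonneg_right zero_le
      refine ⟨V_ ρ, hρ, ?_⟩
      rw [sat_inf, sat_not, sat_rankFormula _ _ _ (by rwa [assign_top]),
        sat_rankFormula _ _ _ (by rwa [assign_top]), assign_top, ZFSet.rank_vonNeumann]
      simp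

/-- The finite part of an ordinal. -/
noncomputable def finitePart (γ : Ordinal.{u}) : ℕ :=
  (Ordinal.lt_omega0.1 (Ordinal.mod_lt γ Ordinal.omega0_ne_zero)).choose

theorem mod_omega0 (γ : Ordinal.{u}) : γ % Ordinal.omega0 = finitePart γ :=
  (Ordinal.lt_omega0.1 (Ordinal.mod_lt γ Ordinal.omega0_ne_zero)).choose_spec

theorem finitePart_omega0_mul_add (ρ : Ordinal.{u}) (j : ℕ) :
    finitePart (Ordinal.omega0 * ρ + j) = j := by
  have h := mod_omega0 (Ordinal.omega0 * ρ + j)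
  rw [Ordinal.mul_add_mod_self, Ordinal.mod_eq_of_lt (Ordinal.natCast_lt_omega0 j)] at h
  exact_mod_cast h.symm

theorem exists_eq_add_iff (γ : Ordinal.{u}) (j : ℕ) :
    (∃ ρ, γ = ρ + j) ↔ j ≤ finitePart γ := by
  constructor
  · rintro ⟨ρ, rfl⟩
    have h : ρ + j =
        Ordinal.omega0 * (ρ / Ordinal.omega0) + ((finitePart ρ + j : ℕ) : Ordinal) := by
      conv_lhs => rw [← Ordinal.div_add_mod ρ Ordinal.omega0, mod_omega0]
      rw [add_assoc, Nat.cast_add]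
    rw [h, finitePart_omega0_mul_add]
    exact Nat.le_add_left _ _
  · intro h
    refine ⟨Ordinal.omega0 * (γ / Ordinal.omega0) + (finitePart γ - j : ℕ), ?_⟩
    rw [add_assoc, ← Nat.cast_add, Nat.sub_add_cancel h, ← mod_omega0, Ordinal.div_add_mod]

/-- Being a `j`-fold successor means having finite part at least `j`, so every eventually constant
property of the finite part is definable without parameters. The induction separates the values from
`N + 1` on and truncates `f` at `N`. -/
theorem exists_formula_finitePart (α : Type*) (f : ℕ → Prop) (N : ℕ) (hf : ∀ i ≥ N, (f i ↔ f N)) :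
    ∃ χ : LSet.Formula α, ∀ (s : α → ZFSet.{u}) γ, Holds χ s γ ↔ f (finitePart γ) := by
  induction N generalizing f with
  | zero =>
    by_cases h0 : f 0
    · exact ⟨∼ ⊥, fun s γ => iff_of_true id ((hf _ (Nat.zero_le _)).2 h0)⟩
    · exact ⟨⊥, fun s γ => iff_of_false id fun h => h0 ((hf _ (Nat.zero_le _)).1 h)⟩
  | succ N ih =>
    obtain ⟨χ, hχ⟩ := ih (fun i => f (min i N)) fun i hi => by
      rw [min_eq_right hi, min_self]
    have key : ∀ (s : α → ZFSet.{u}) γ, Holds (successorFormula α (N + 1)) s γ ↔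
        N + 1 ≤ finitePart γ := fun s γ => by
      rw [holds_successorFormula, exists_eq_add_iff]
    by_cases hN : f (N + 1)
    · refine ⟨successorFormula α (N + 1) ⊔ χ, fun s γ => ?_⟩
      have : Holds (successorFormula α (N + 1) ⊔ χ) s γ ↔
        Holds (successorFormula α (N + 1)) s γ ∨ Holds χ s γ := sat_sup _ _ _ _
      rw [this, key, hχ]
      by_cases h : N + 1 ≤ finitePart γ
      · exact iff_of_true (Or.inl h) ((hf _ h).2 hN)
      · simp only [h, false_or, min_eq_left (Nat.lt_succ_iff.1 (not_le.1 h))]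
    · refine ⟨∼ (successorFormula α (N + 1)) ⊓ χ, fun s γ => ?_⟩
      have : Holds (∼ (successorFormula α (N + 1)) ⊓ χ) s γ ↔
        ¬ Holds (successorFormula α (N + 1)) s γ ∧ Holds χ s γ := sat_inf _ _ _ _
      rw [this, key, hχ]
      by_cases h : N + 1 ≤ finitePart γ
      · exact iff_of_false (fun h' => h'.1 h) fun h' => hN ((hf _ h).1 h')
      · simp only [h, not_false_eq_true, true_and, min_eq_left (Nat.lt_succ_iff.1 (not_le.1 h))]

theorem validities_subset_s5 (δ : Ordinal.{u}) (v : α → World δ) : validities δ v ⊆ S5 := by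
  intro φ hφ
  rw [mem_validities] at hφ
  by_contra hc
  obtain ⟨S, hS, w, hw, hnot⟩ := exists_not_evalS5 hc
  have := hS.to_subtype
  obtain ⟨N, ⟨f⟩⟩ := Finite.exists_equiv_fin S
  let k := finitePart δ
  -- Finite parts are labelled with worlds of the refuting model: the `N` numbers after `k`
  -- enumerate `S`, and all others get `w`. Thus `δ` itself carries the refuting world and the
  -- labelling is eventually constant.
  let e : ℕ → ℕ → Prop := fun i =>
    if h : k < i ∧ i - k - 1 < N then (f.symm ⟨i - k - 1, h.2⟩).1 else w
  have hek : e k = w := dif_neg fun h => h.1.false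
  have heS : ∀ i, e i ∈ S := by
    intro i
    by_cases h : k < i ∧ i - k - 1 < N
    · simp only [e, dif_pos h, Subtype.coe_prop]
    · simpa only [e, dif_neg h] using hw
  have hsurj : ∀ x ∈ S, ∃ i, e i = x := by
    intro x hx
    have h : k < k + 1 + (f ⟨x, hx⟩).1 ∧ k + 1 + (f ⟨x, hx⟩).1 - k - 1 < N :=
      ⟨by omega, by have := (f ⟨x, hx⟩).2; omega⟩
    refine ⟨k + 1 + (f ⟨x, hx⟩).1, ?_⟩
    simp only [e, dif_pos h]
    have : (⟨k + 1 + (f ⟨x, hx⟩).1 - k - 1, h.2⟩ : Fin N) = f ⟨x, hx⟩ := Fin.ext (by simp; omega)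
    rw [this, Equiv.symm_apply_apply]
  have heN : ∀ i ≥ k + 1 + N, e i = w := fun i hi => dif_neg fun h => by omega
  choose ψ hψ using fun i => exists_formula_finitePart.{u} α (fun j => e j i) (k + 1 + N)
    fun j hj => by rw [heN j hj, heN _ le_rfl]
  apply hnot
  have hval : (fun i => Holds (ψ i) fun a => (v a).1) = fun i γ => e (finitePart γ) i := by
    funext i γ
    exact propext (hψ i _ γ)
  have h := hφ ψ
  rw [hval, forces_iff_evalS5 (S := S) (w := fun γ => e (finitePart γ)) (fun γ => heS _)] at h
  · rwa [show e (finitePart δ) = w from hek] at h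
  · intro x hx γ
    obtain ⟨i, rfl⟩ := hsurj x hx
    refine ⟨Ordinal.omega0 * γ + i, ?_, by rw [finitePart_omega0_mul_add]⟩
    exact (Ordinal.le_mul_right γ Ordinal.omega0_pos).trans (le_add_of_nonneg_right zero_le)

theorem SigmaCorrect.validities_eq {δ : Ordinal.{u}} (hδ : SigmaCorrect 3 δ) (v : α → World δ) :
    validities δ v = S5 :=
  (validities_subset_s5 δ v).antisymm (hδ.s5_subset_validities v)

end Control

/-! ### Worlds with Mostowski collapses -/

section Collapse

variable {α : Type*} {n : ℕ}

/-- `t = {x, y}`. -/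
def unorderedPairFormula (t x y : α ⊕ Fin n) : LSet.BoundedFormula α n :=
  memFormula x t ⊓ memFormula y t ⊓ boundedAll t (eqFormula top (up x) ⊔ eqFormula top (up y))

theorem sat_unorderedPair {A : Set ZFSet.{u}} (hA : TransClass A) {s : α ⊕ Fin n → ZFSet.{u}}
    {t x y : α ⊕ Fin n} (ht : s t ∈ A) :
    Sat A (unorderedPairFormula t x y) s ↔ s t = {s x, s y} := by
  rw [unorderedPairFormula, sat_inf, hA.sat_boundedAll ht, sat_inf]
  simp only [sat_mem, sat_sup, sat_eq, assign_top, assign_up]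
  constructor
  · rintro ⟨⟨hx, hy⟩, h⟩
    ext z
    rw [ZFSet.mem_pair]
    refine ⟨h z, ?_⟩
    rintro (rfl | rfl)
    exacts [hx, hy]
  · intro h
    rw [h]
    simp

/-- `p = ⟨x, y⟩`. -/
def pairFormula (p x y : α ⊕ Fin n) : LSet.BoundedFormula α n :=
  boundedEx p (boundedEx (up p) (unorderedPairFormula (up (up p)) (up top) top ⊓
    (unorderedPairFormula (up top) (up (up x)) (up (up x)) ⊓
      unorderedPairFormula top (up (up x)) (up (up y)))))

theorem sat_pair {A : Set ZFSet.{u}} (hA : TransClass A) {s : α ⊕ Fin n → ZFSet.{u}}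
    {p x y : α ⊕ Fin n} (hp : s p ∈ A) :
    Sat A (pairFormula p x y) s ↔ s p = ZFSet.pair (s x) (s y) := by
  have key : ∀ a ∈ s p, ∀ b ∈ s p, (Sat A (unorderedPairFormula (up (up p)) (up top) top ⊓
      (unorderedPairFormula (up top) (up (up x)) (up (up x)) ⊓
        unorderedPairFormula top (up (up x)) (up (up y)))) (assign (assign s a) b) ↔
      s p = {a, b} ∧ a = {s x, s x} ∧ b = {s x, s y}) := by
    intro a ha b hb
    rw [sat_inf, sat_inf, sat_unorderedPair hA (by simpa using hp),
      sat_unorderedPair hA (by simpa using hA _ hp _ ha),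
      sat_unorderedPair hA (by simpa using hA _ hp _ hb)]
    simp
  rw [pairFormula, hA.sat_boundedEx hp]
  constructor
  · rintro ⟨a, ha, h⟩
    rw [hA.sat_boundedEx (by simpa using hp), assign_up] at h
    obtain ⟨b, hb, h⟩ := h
    obtain ⟨h, rfl, rfl⟩ := (key a ha b hb).1 h
    rw [h, ZFSet.pair, ZFSet.pair_eq_singleton]
  · intro h
    have ha : ({s x} : ZFSet.{u}) ∈ s p := by simp [h, ZFSet.pair]
    have hb : ({s x, s y} : ZFSet.{u}) ∈ s p := by simp [h, ZFSet.pair]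
    refine ⟨{s x}, ha, ?_⟩
    rw [hA.sat_boundedEx (by simpa using hp), assign_up]
    exact ⟨_, hb, (key _ ha _ hb).2 ⟨h, (ZFSet.pair_eq_singleton _).symm, rfl⟩⟩

/-- `⟨x, y⟩ ∈ r`. -/
def pairMemFormula (r x y : α ⊕ Fin n) : LSet.BoundedFormula α n :=
  boundedEx r (pairFormula top (up x) (up y))

theorem sat_pairMem {A : Set ZFSet.{u}} (hA : TransClass A) {s : α ⊕ Fin n → ZFSet.{u}}
    {r x y : α ⊕ Fin n} (hr : s r ∈ A) :
    Sat A (pairMemFormula r x y) s ↔ ZFSet.pair (s x) (s y) ∈ s r := by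
  rw [pairMemFormula, hA.sat_boundedEx hr]
  constructor
  · rintro ⟨p, hp, h⟩
    rw [sat_pair hA (by simpa using hA _ hr _ hp)] at h
    simp only [assign_top, assign_up] at h
    rwa [← h]
  · intro h
    refine ⟨_, h, ?_⟩
    rw [sat_pair hA (by simpa using hA _ hr _ h)]
    simp

/-- `x` is a nonempty set each of whose elements `v` has an `r`-predecessor in `x`. -/
def IsIllFounded (r x : ZFSet.{u}) : Prop :=
  (∃ v, v ∈ x) ∧ ∀ v ∈ x, ∃ u ∈ x, ZFSet.pair u v ∈ r

/-- `f` is a collapse of the relation `r` on `d`, as seen by the class `A`. -/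
def IsCollapse (A : Set ZFSet.{u}) (d r f : ZFSet.{u}) : Prop :=
  (∀ v ∈ d, ∃ z ∈ A, ZFSet.pair v z ∈ f) ∧ ∀ v ∈ A, ∀ z ∈ A, ZFSet.pair v z ∈ f →
    ∀ t ∈ A, (t ∈ z ↔ ∃ u ∈ A, ZFSet.pair u v ∈ r ∧ ZFSet.pair u t ∈ f)

/-- The class `A` has no last level, contains an infinite set, and contains collapses of all
well-founded relations in `A`. -/
structure HasCollapses (A : Set ZFSet.{u}) : Prop where
  limit : ∀ x ∈ A, ∃ y ∈ A, x ∈ y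
  infinite : ∃ x ∈ A, (∃ y, y ∈ x) ∧ ∀ y ∈ x, ∃ z ∈ x, y ∈ z
  collapse : ∀ d ∈ A, ∀ r ∈ A, (∃ x ∈ A, IsIllFounded r x) ∨ ∃ f ∈ A, IsCollapse A d r f

/-- The formula `IsIllFounded r x`. -/
def illFoundedFormula (r x : α ⊕ Fin n) : LSet.BoundedFormula α n :=
  boundedEx x (∼ ⊥) ⊓ boundedAll x (boundedEx (up x) (pairMemFormula (up (up r)) top (up top)))

theorem sat_illFounded {A : Set ZFSet.{u}} (hA : TransClass A) {s : α ⊕ Fin n → ZFSet.{u}}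
    {r x : α ⊕ Fin n} (hr : s r ∈ A) (hx : s x ∈ A) :
    Sat A (illFoundedFormula r x) s ↔ IsIllFounded (s r) (s x) := by
  rw [illFoundedFormula, sat_inf, hA.sat_boundedAll hx, hA.sat_boundedEx hx]
  refine and_congr (by simp) (forall₂_congr fun v hv => ?_)
  rw [hA.sat_boundedEx (by simpa using hx), assign_up]
  refine exists_congr fun u => and_congr_right fun hu => ?_
  rw [sat_pairMem hA (by simpa using hr)]
  simp

/-- The formula `IsCollapse d r f`. -/
def collapseFormula (d r f : α ⊕ Fin n) : LSet.BoundedFormula α n :=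
  boundedAll d (pairMemFormula (up (up f)) (up top) top).ex ⊓
    ((pairMemFormula (up (up f)) (up top) top).imp
      ((memFormula top (up top)).iff
        (pairMemFormula (up (up (up (up r)))) top (up (up (up top))) ⊓
          pairMemFormula (up (up (up (up f)))) top (up top)).ex).all).all.all

theorem sat_collapse {A : Set ZFSet.{u}} (hA : TransClass A) {s : α ⊕ Fin n → ZFSet.{u}}
    {d r f : α ⊕ Fin n} (hd : s d ∈ A) (hr : s r ∈ A) (hf : s f ∈ A) :
    Sat A (collapseFormula d r f) s ↔ IsCollapse A (s d) (s r) (s f) := by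
  rw [collapseFormula, sat_inf, hA.sat_boundedAll hd, sat_all]
  simp only [sat_ex, sat_all, sat_imp, sat_iff]
  refine and_congr (forall₂_congr fun v hv => exists_congr fun z => and_congr_right fun hz => ?_)
    (forall₂_congr fun v hv => forall₂_congr fun z hz => imp_congr ?_ (forall₂_congr fun t ht =>
      iff_congr (by simp) (exists_congr fun u => and_congr_right fun hu => ?_)))
  · rw [sat_pairMem hA (by simpa using hf)]
    simp
  · rw [sat_pairMem hA (by simpa using hf)]
    simp
  · rw [sat_inf, sat_pairMem hA (by simpa using hr), sat_pairMem hA (by simpa using hf)]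
    simp

/-- The sentence expressing `HasCollapses`. -/
def collapsesSentence (α : Type*) : LSet.Formula α :=
  ((memFormula (up top) top).ex.all ⊓
    (boundedEx top (∼ ⊥) ⊓ boundedAll top (boundedEx (up top) (memFormula (up top) top))).ex) ⊓
    ((illFoundedFormula (up top) top).ex ⊔ (collapseFormula (up (up top)) (up top) top).ex).all.all

theorem sat_collapsesSentence {A : Set ZFSet.{u}} (hA : TransClass A)
    (s : α ⊕ Fin 0 → ZFSet.{u}) : Sat A (collapsesSentence α) s ↔ HasCollapses A := by
  have h₁ : Sat A (memFormula (up top) top).ex.all s ↔ ∀ x ∈ A, ∃ y ∈ A, x ∈ y := by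
    simp
  have h₂ : Sat A (boundedEx top (∼ ⊥) ⊓
      boundedAll top (boundedEx (up top) (memFormula (up top) top))).ex s ↔
      ∃ x ∈ A, (∃ y, y ∈ x) ∧ ∀ y ∈ x, ∃ z ∈ x, y ∈ z := by
    rw [sat_ex]
    refine exists_congr fun x => and_congr_right fun hx => ?_
    rw [sat_inf, hA.sat_boundedEx (by simpa using hx), hA.sat_boundedAll (by simpa using hx)]
    simp only [assign_top]
    refine and_congr (by simp) (forall₂_congr fun y hy => ?_)
    rw [hA.sat_boundedEx (by simpa using hx)]
    simp
  have h₃ : Sat A ((illFoundedFormula (up top) top).ex ⊔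
      (collapseFormula (up (up top)) (up top) top).ex).all.all s ↔
      ∀ d ∈ A, ∀ r ∈ A, (∃ x ∈ A, IsIllFounded r x) ∨ ∃ f ∈ A, IsCollapse A d r f := by
    simp only [sat_all, sat_sup, sat_ex]
    refine forall₂_congr fun d hd => forall₂_congr fun r hr => or_congr
      (exists_congr fun x => and_congr_right fun hx => ?_)
      (exists_congr fun f => and_congr_right fun hf => ?_)
    · rw [sat_illFounded hA (by simpa using hr) (by simpa using hx)]
      simp
    · rw [sat_collapse hA (by simpa using hd) (by simpa using hr) (by simpa using hf)]
      simp
  rw [collapsesSentence, sat_inf, sat_inf, h₁, h₂, h₃]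
  exact ⟨fun ⟨⟨h, h'⟩, h''⟩ => ⟨h, h', h''⟩, fun ⟨h, h', h''⟩ => ⟨⟨h, h'⟩, h''⟩⟩

/-- The universe has Mostowski collapses. -/
theorem hasCollapses_univ : HasCollapses (Set.univ : Set ZFSet.{u}) where
  limit x _ := ⟨{x}, trivial, by simp⟩
  infinite := ⟨ZFSet.omega, trivial, ⟨∅, ZFSet.omega_zero⟩,
    fun y hy => ⟨insert y y, ZFSet.omega_succ hy, by simp⟩⟩
  collapse d _ r _ := by
    let R : d → d → Prop := fun u v => ZFSet.pair u.1 v.1 ∈ r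
    by_cases hR : WellFounded R
    · right
      -- The collapse `c v = {c u | u R v}`, by well-founded recursion.
      let c : d → ZFSet.{u} := hR.fix fun v ih =>
        ZFSet.range fun u : {u : d // R u v} => ih u.1 u.2
      have hc : ∀ v t, t ∈ c v ↔ ∃ u, R u v ∧ c u = t := by
        intro v t
        simp only [c]
        rw [hR.fix_eq, ZFSet.mem_range]
        simp
      have hf : ∀ v z, ZFSet.pair v z ∈ ZFSet.range (fun v : d => ZFSet.pair v.1 (c v)) ↔
          ∃ h : v ∈ d, z = c ⟨v, h⟩ := by
        intro v z
        rw [ZFSet.mem_range]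
        constructor
        · rintro ⟨v', h⟩
          obtain ⟨rfl, rfl⟩ := ZFSet.pair_inj.1 h
          exact ⟨v'.2, rfl⟩
        · rintro ⟨h, rfl⟩
          exact ⟨⟨v, h⟩, rfl⟩
      refine ⟨ZFSet.range fun v : d => ZFSet.pair v.1 (c v), trivial, fun v hv =>
        ⟨_, trivial, (hf v _).2 ⟨hv, rfl⟩⟩, fun v _ z _ hz t _ => ?_⟩
      obtain ⟨hv, rfl⟩ := (hf v z).1 hz
      rw [hc]
      constructor
      · rintro ⟨u, hu, rfl⟩
        exact ⟨u.1, trivial, hu, (hf _ _).2 ⟨u.2, rfl⟩⟩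
      · rintro ⟨u, -, hu, hut⟩
        obtain ⟨hud, rfl⟩ := (hf _ _).1 hut
        exact ⟨⟨u, hud⟩, hu, rfl⟩
    · left
      have hacc : ∃ v, ¬ Acc R v := by
        by_contra! h
        exact hR ⟨h⟩
      obtain ⟨v, hv⟩ := hacc
      -- The non-accessible elements form an ill-founded set.
      refine ⟨ZFSet.sep (fun x => ∃ h : x ∈ d, ¬ Acc R ⟨x, h⟩) d, trivial,
        ⟨v.1, ZFSet.mem_sep.2 ⟨v.2, v.2, hv⟩⟩, fun x hx => ?_⟩
      obtain ⟨-, hxd, hx⟩ := ZFSet.mem_sep.1 hx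
      by_contra! hc
      refine hx ⟨_, fun y hy => ?_⟩
      by_contra hy'
      exact hc y.1 (ZFSet.mem_sep.2 ⟨y.2, y.2, hy'⟩) hy

/-- There are arbitrarily large fully elementary worlds. -/
theorem exists_elementary (β : Ordinal.{u}) : ∃ l ≥ β, ∀ (m n : ℕ)
    (φ : LSet.BoundedFormula (Fin m) n) (s : Fin m ⊕ Fin n → ZFSet.{u}), (∀ i, s i ∈ V_ l) →
      (Sat (V_ l : Set ZFSet.{u}) φ s ↔ Sat Set.univ φ s) := by
  -- Replacement: there is only a small family of formulas with parameters in `V_b`, so the ranks of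
  -- chosen witnesses are bounded. Since `Sat Set.univ` treats all formulas at once, iterating `c`
  -- gives full elementarity by the Tarski–Vaught argument.
  have hbound : ∀ b : Ordinal.{u}, ∃ c ≥ b, ∀ (m n : ℕ) (φ : LSet.BoundedFormula (Fin m) (n + 1))
      (s : Fin m ⊕ Fin n → ZFSet.{u}), (∀ i, s i ∈ V_ b) → (∃ x, Sat Set.univ φ (assign s x)) →
        ∃ x ∈ V_ c, Sat Set.univ φ (assign s x) := by
    intro b
    let I := Σ m : ℕ, Σ n : ℕ,
      LSet.BoundedFormula (Fin m) (n + 1) × (Fin m ⊕ Fin n → (V_ b : ZFSet.{u}))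
    have hx : ∀ i : I, ∃ x : ZFSet.{u},
        (∃ x, Sat Set.univ i.2.2.1 (assign (fun j => (i.2.2.2 j).1) x)) →
          Sat Set.univ i.2.2.1 (assign (fun j => (i.2.2.2 j).1) x) := by
      intro i
      by_cases h : ∃ x, Sat Set.univ i.2.2.1 (assign (fun j => (i.2.2.2 j).1) x)
      · obtain ⟨x, hx⟩ := h
        exact ⟨x, fun _ => hx⟩
      · exact ⟨∅, fun h' => (h h').elim⟩
    choose w hw using hx
    refine ⟨max b (⨆ i, Order.succ (w i).rank), le_max_left _ _, fun m n φ s hs h => ?_⟩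
    let i : I := ⟨m, n, φ, fun j => ⟨s j, hs j⟩⟩
    refine ⟨w i, ?_, hw i h⟩
    rw [ZFSet.mem_vonNeumann]
    refine lt_of_lt_of_le (Order.lt_succ _) (le_max_of_le_right ?_)
    exact Ordinal.le_iSup (fun i => Order.succ (w i).rank) i
  choose c hc hw using hbound
  let b : ℕ → Ordinal.{u} := fun k => c^[k] β
  have hb : Monotone b := monotone_nat_of_le_succ fun k => by
    simp only [b, Function.iterate_succ_apply']
    exact hc _
  have hle : ∀ k, b k ≤ ⨆ k, b k := Ordinal.le_iSup b
  refine ⟨⨆ k, b k, hle 0, fun m n φ => ?_⟩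
  induction φ with
  | falsum => exact fun _ _ => Iff.rfl
  | equal => exact fun _ _ => Iff.rfl
  | rel => exact fun _ _ => Iff.rfl
  | imp φ ψ h₁ h₂ => exact fun s hs => by rw [sat_imp, sat_imp, h₁ s hs, h₂ s hs]
  | @all n φ h =>
    intro s hs
    refine ⟨fun H => ?_, fun H x hx => (h _ (assign_mem (A := (V_ (⨆ k, b k) : Set ZFSet.{u}))
      hs hx)).2 (H x trivial)⟩
    by_contra hcon
    rw [sat_all] at hcon
    push Not at hcon
    obtain ⟨x, -, hx⟩ := hcon
    have hk : ∀ i, ∃ k, s i ∈ V_ (b k) := by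
      intro i
      have := ZFSet.mem_vonNeumann.1 (hs i)
      rw [Ordinal.lt_iSup_iff] at this
      obtain ⟨k, hk⟩ := this
      exact ⟨k, ZFSet.mem_vonNeumann.2 hk⟩
    choose k hk using hk
    -- The finitely many parameters all occur at stage `K`, so a witness appears at stage `K + 1`.
    let K := Finset.univ.sup k
    have hsK : ∀ i, s i ∈ V_ (b K) := fun i =>
      vonNeumann_subset_coe (hb (Finset.le_sup (Finset.mem_univ i))) (hk i)
    obtain ⟨y, hy, hy'⟩ := hw (b K) m n (∼ φ) s hsK ⟨x, hx⟩
    have hyl : y ∈ (V_ (⨆ k, b k) : Set ZFSet.{u}) := by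
      refine vonNeumann_subset_coe ?_ hy
      have := hle (K + 1)
      simpa only [b, Function.iterate_succ_apply'] using this
    exact hy' ((h _ (assign_mem (A := (V_ (⨆ k, b k) : Set ZFSet.{u})) hs hyl)).1 (H y hyl))

theorem exists_hasCollapses (β : Ordinal.{u}) :
    ∃ l ≥ β, HasCollapses (V_ l : Set ZFSet.{u}) := by
  obtain ⟨l, hl, h⟩ := exists_elementary β
  refine ⟨l, hl, ?_⟩
  let s : Fin 0 ⊕ Fin 0 → ZFSet.{u} := Sum.elim Fin.elim0 Fin.elim0
  rw [← sat_collapsesSentence (transClass_vonNeumann l) s, h 0 0 _ s (by simp),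
    sat_collapsesSentence transClass_univ]
  exact hasCollapses_univ

end Collapse

/-! ### `Σ₁`-correctness of worlds with Mostowski collapses -/

section SigmaOne

variable {α : Type*} {n : ℕ}

namespace HasCollapses

variable {l : Ordinal.{u}}

theorem succ_lt (hl : HasCollapses (V_ l : Set ZFSet.{u})) {ξ : Ordinal.{u}} (hξ : ξ < l) :
    ξ + 1 < l := by
  obtain ⟨y, hy, h⟩ := hl.limit (V_ ξ) (ZFSet.vonNeumann_mem_of_lt hξ)
  have h' := ZFSet.rank_lt_of_mem h
  rw [ZFSet.rank_vonNeumann] at h'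
  exact (Order.add_one_le_of_lt h').trans_lt (ZFSet.mem_vonNeumann.1 hy)

theorem omega0_lt (hl : HasCollapses (V_ l : Set ZFSet.{u})) : Ordinal.omega0 < l := by
  obtain ⟨x, hx, ⟨y, hy⟩, h⟩ := hl.infinite
  have key : ∀ k : ℕ, ∃ z ∈ x, (k : Ordinal.{u}) ≤ z.rank := by
    intro k
    induction k with
    | zero => exact ⟨y, hy, by simp⟩
    | succ k ih =>
      obtain ⟨z, hz, hk⟩ := ih
      obtain ⟨z', hz', hzz'⟩ := h z hz
      refine ⟨z', hz', ?_⟩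
      rw [Nat.cast_add, Nat.cast_one]
      exact Order.add_one_le_of_lt (hk.trans_lt (ZFSet.rank_lt_of_mem hzz'))
  refine lt_of_le_of_lt ?_ (ZFSet.mem_vonNeumann.1 hx)
  rw [Ordinal.omega0_le]
  intro k
  obtain ⟨z, hz, hk⟩ := key k
  exact hk.trans (ZFSet.rank_lt_of_mem hz).le

/-- The Mostowski collapse, inside `V_λ`, of an extensional class of sets that embeds into `V_ξ`. -/
theorem exists_collapse (hl : HasCollapses (V_ l : Set ZFSet.{u})) {ξ : Ordinal.{u}} (hξ : ξ < l)
    {M : Type*} (ι e : M → ZFSet.{u}) (he : Function.Injective e)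
    (heξ : ∀ a, e a ∈ V_ ξ) (hsub : ∀ x ∈ V_ ξ, ∃ a, ι a = x)
    (hext : ∀ a b, (∀ c, ι c ∈ ι a ↔ ι c ∈ ι b) → a = b) :
    ∃ π : M → ZFSet.{u}, Function.Injective π ∧ (∀ a b, π a ∈ π b ↔ ι a ∈ ι b) ∧
      (∀ a, π a ∈ V_ l) ∧ TransClass (Set.range π) ∧ ∀ a, ι a ∈ V_ ξ → π a = ι a := by
  have hpair : ∀ a b, ZFSet.pair (e a) (e b) ∈ V_ (ξ + 1 + 1) := by
    intro a b
    rw [ZFSet.vonNeumann_add_one, ZFSet.mem_powerset, ZFSet.vonNeumann_add_one]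
    intro t ht
    rw [ZFSet.pair, ZFSet.mem_pair] at ht
    rw [ZFSet.mem_powerset]
    intro z hz
    rcases ht with rfl | rfl
    · rw [ZFSet.mem_singleton] at hz
      exact hz ▸ heξ a
    · rw [ZFSet.mem_pair] at hz
      rcases hz with rfl | rfl <;> apply heξ
  -- Membership on `M`, copied into `V_ξ` along `e`. This is an element of `V_l` even where the
  -- values of `ι` are not.
  let r := ZFSet.sep (fun p => ∃ a b, ι a ∈ ι b ∧ p = ZFSet.pair (e a) (e b)) (V_ (ξ + 1 + 1))
  have hr : ∀ x b, ZFSet.pair x (e b) ∈ r ↔ ∃ a, ι a ∈ ι b ∧ x = e a := by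
    intro x b
    rw [ZFSet.mem_sep]
    constructor
    · rintro ⟨-, a, b', h, hp⟩
      obtain ⟨rfl, hb⟩ := ZFSet.pair_inj.1 hp
      exact ⟨a, he hb ▸ h, rfl⟩
    · rintro ⟨a, h, rfl⟩
      exact ⟨hpair a b, a, b, h, rfl⟩
  have hrl : r ∈ V_ l := by
    refine ZFSet.mem_vonNeumann_of_subset (y := V_ (ξ + 1 + 1)) ZFSet.sep_subset ?_
    rw [ZFSet.vonNeumann_mem_vonNeumann_iff]
    exact hl.succ_lt (hl.succ_lt hξ)
  have hT := transClass_vonNeumann l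
  rcases hl.collapse _ (ZFSet.vonNeumann_mem_of_lt hξ) r hrl with ⟨x, hx, ⟨v, hv⟩, hxr⟩ | h
  -- An ill-founded set for `r` would give one for `∈`.
  · exfalso
    have hno : ∀ z : ZFSet.{u}, ∀ a, ι a = z → e a ∉ x := by
      intro z
      induction z using ZFSet.inductionOn with
      | h z ih =>
        rintro a rfl ha
        obtain ⟨u, hu, hur⟩ := hxr _ ha
        obtain ⟨b, hb, rfl⟩ := (hr u a).1 hur
        exact ih _ hb b rfl hu
    obtain ⟨u, hu, hur⟩ := hxr v hv
    obtain ⟨-, a, b, -, hp⟩ := ZFSet.mem_sep.1 hur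
    obtain ⟨rfl, -⟩ := ZFSet.pair_inj.1 hp
    exact hno _ a rfl hu
  · obtain ⟨f, -, hdom, hf⟩ := h
    choose π hπl hπ using fun a => hdom (e a) (heξ a)
    have hel : ∀ a, e a ∈ (V_ l : Set ZFSet.{u}) := fun a =>
      vonNeumann_subset_coe hξ.le (heξ a)
    -- `f` is not assumed to be a function; two values at `e a` have the same elements by the
    -- collapse clause.
    have huniq : ∀ a, ∀ t ∈ (V_ l : Set ZFSet.{u}), ZFSet.pair (e a) t ∈ f → t = π a := by
      intro a t ht hat
      ext x
      constructor
      · intro hx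
        have hxl := hT _ ht _ hx
        exact (hf _ (hel a) _ (hπl a) (hπ a) x hxl).2 ((hf _ (hel a) t ht hat x hxl).1 hx)
      · intro hx
        have hxl := hT _ (hπl a) _ hx
        exact (hf _ (hel a) t ht hat x hxl).2 ((hf _ (hel a) _ (hπl a) (hπ a) x hxl).1 hx)
    have hmem : ∀ a t, t ∈ π a ↔ ∃ b, ι b ∈ ι a ∧ t = π b := by
      intro a t
      constructor
      · intro ht
        have htl := hT _ (hπl a) _ ht
        obtain ⟨u, -, hur, huf⟩ := (hf _ (hel a) _ (hπl a) (hπ a) t htl).1 ht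
        obtain ⟨b, hb, rfl⟩ := (hr u a).1 hur
        exact ⟨b, hb, huniq b t htl huf⟩
      · rintro ⟨b, hb, rfl⟩
        exact (hf _ (hel a) _ (hπl a) (hπ a) _ (hπl b)).2
          ⟨e b, hel b, (hr _ _).2 ⟨b, hb, rfl⟩, hπ b⟩
    have hinj : ∀ z : ZFSet.{u}, ∀ a, ι a = z → ∀ b, π a = π b → a = b := by
      intro z
      induction z using ZFSet.inductionOn with
      | h z ih =>
        rintro a rfl b hab
        refine hext a b fun c => ⟨fun hc => ?_, fun hc => ?_⟩
        · obtain ⟨c', hc', h⟩ := (hmem b _).1 (hab ▸ (hmem a _).2 ⟨c, hc, rfl⟩)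
          rwa [ih _ hc c rfl c' h]
        · obtain ⟨c', hc', h⟩ := (hmem a _).1 (hab.symm ▸ (hmem b _).2 ⟨c, hc, rfl⟩)
          rwa [← ih _ hc' c' rfl c h.symm]
    have hinj' : Function.Injective π := fun a b => hinj _ a rfl b
    refine ⟨π, hinj', fun a b => ?_, hπl, ?_, ?_⟩
    · rw [hmem]
      exact ⟨fun ⟨c, hc, h⟩ => hinj' h ▸ hc, fun h => ⟨a, h, rfl⟩⟩
    · rintro _ ⟨a, rfl⟩ t ht
      obtain ⟨b, -, rfl⟩ := (hmem a t).1 ht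
      exact ⟨b, rfl⟩
    -- By `hsub`, no element of a member of `V_ξ` is missing from the range of `ι`, so the collapse
    -- moves nothing there.
    · have hfix : ∀ z : ZFSet.{u}, ∀ a, ι a = z → ι a ∈ V_ ξ → π a = ι a := by
        intro z
        induction z using ZFSet.inductionOn with
        | h z ih =>
          rintro a rfl ha
          ext t
          rw [hmem]
          constructor
          · rintro ⟨b, hb, rfl⟩
            rwa [ih _ hb b rfl (ZFSet.isTransitive_vonNeumann ξ _ ha hb)]
          · intro ht
            have htξ := ZFSet.isTransitive_vonNeumann ξ _ ha ht
            obtain ⟨b, rfl⟩ := hsub t htξ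
            exact ⟨b, ht, (ih _ ht b rfl htξ).symm⟩
      exact fun a => hfix _ a rfl

end HasCollapses

theorem card_lSet_le : LSet.card ≤ Cardinal.aleph0 := by
  have h : Countable LSet.Symbols := by
    have : Countable (Σ k, LSet.Relations k) := by
      refine Function.Injective.countable (f := Sigma.fst) ?_
      rintro ⟨_, a⟩ ⟨_, b⟩ h
      cases a
      cases b
      rfl
    have : IsEmpty (Σ k, LSet.Functions k) := ⟨fun x => x.2.elim⟩
    exact instCountableSum
  exact Cardinal.mk_le_aleph0_iff.2 h

/-- The axiom of extensionality. -/
def extensionality : LSet.Sentence :=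
  (((memFormula top (up (up top))).iff (memFormula top (up top))).all.imp
    (eqFormula (up top) top)).all.all

theorem infinite_vonNeumann {ξ : Ordinal.{u}} (hξ : Ordinal.omega0 ≤ ξ) :
    Infinite (V_ ξ : ZFSet.{u}) :=
  Infinite.of_injective (fun k : ℕ => ⟨V_ (k : Ordinal.{u}), by
    rw [ZFSet.vonNeumann_mem_vonNeumann_iff]
    exact (Ordinal.natCast_lt_omega0 k).trans_le hξ⟩) fun a b h => by
      simpa using h

/-- A world with Mostowski collapses is `Σ₁`-correct. -/
theorem HasCollapses.sat_of_sigma_one {l : Ordinal.{u}} (hl : HasCollapses (V_ l : Set ZFSet.{u}))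
    {φ : LSet.BoundedFormula α n} (hφ : IsSigma 1 n φ) {s : α ⊕ Fin n → ZFSet.{u}}
    {ξ : Ordinal.{u}} (hξ : ξ < l) (hs : ∀ i, s i ∈ V_ ξ) (h : Sat Set.univ φ s) :
    Sat (V_ l : Set ZFSet.{u}) φ s := by
  -- An infinite `V_ξ` is needed for a hull of exactly its cardinality.
  wlog hω : Ordinal.omega0 ≤ ξ generalizing ξ
  · exact this (max_lt hξ hl.omega0_lt) (fun i => vonNeumann_subset_coe (le_max_left _ _) (hs i))
      (le_max_right _ _)
  obtain ⟨γ, hγ⟩ := sigma_one_eventually hφ (β := ξ) hs h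
  let τ := max γ ξ
  have hτ : Sat (V_ τ : Set ZFSet.{u}) φ s := hγ τ (le_max_left _ _)
  have hξτ : (V_ ξ : Set ZFSet.{u}) ⊆ (V_ τ : Set ZFSet.{u}) :=
    vonNeumann_subset_coe (le_max_right _ _)
  let X : Set (World τ) := {x | x.1 ∈ V_ ξ}
  have hX : Infinite X := by
    have := infinite_vonNeumann hω
    exact Infinite.of_injective (fun x : (V_ ξ : ZFSet.{u}) => (⟨⟨x.1, hξτ x.2⟩, x.2⟩ : X))
      fun a b h => Subtype.ext (congrArg (fun x : X => x.1.1) h)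
  -- An elementary submodel of `V_τ` that includes `V_ξ` and is equinumerous with it. Its collapse
  -- is a transitive part of `V_l` that fixes the parameters, and `Σ₁` truth passes from there up to
  -- `V_l`.
  obtain ⟨S, hXS, hS⟩ := exists_elementarySubstructure_card_eq LSet X (Cardinal.mk X)
    (Cardinal.aleph0_le_mk X) le_rfl
    ((Cardinal.lift_le.2 card_lSet_le).trans (by simp)) (Cardinal.lift_le.2 (Cardinal.mk_set_le X))
  rw [Cardinal.lift_id, Cardinal.lift_id] at hS
  obtain ⟨e⟩ := Cardinal.eq.1 hS
  let ι : S → ZFSet.{u} := fun a => a.1.1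
  have hι : Function.Injective ι := fun a b h => Subtype.ext (Subtype.ext h)
  have hmemι : ∀ xs : Fin 2 → S,
      Structure.RelMap (L := LSet) SetRel.mem xs ↔ ι (xs 0) ∈ ι (xs 1) := fun xs => Iff.rfl
  have hext : ∀ a b : S, (∀ c : S, ι c ∈ ι a ↔ ι c ∈ ι b) → a = b := by
    have h₁ : extensionality.Realize (World τ) := by
      rw [Sentence.Realize, Formula.Realize, realize_world]
      simp only [extensionality, sat_all, sat_imp, sat_iff, sat_mem, sat_eq, assign_top, assign_up]
      intro x hx y hy hxy
      ext z
      exact ⟨fun hz => (hxy z (transClass_vonNeumann τ _ hx _ hz)).1 hz,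
        fun hz => (hxy z (transClass_vonNeumann τ _ hy _ hz)).2 hz⟩
    have h₂ : extensionality.Realize S := (S.subtype.map_sentence _).2 h₁
    rw [Sentence.Realize, Formula.Realize, realize_iff_sat ι hι hmemι] at h₂
    simp only [extensionality, sat_all, sat_imp, sat_iff, sat_mem, sat_eq, assign_top, assign_up,
      Set.forall_mem_range] at h₂
    exact fun a b hab => hι (h₂ a b hab)
  obtain ⟨π, hπ, hπmem, hπl, hπT, hπfix⟩ := hl.exists_collapse hξ ι (fun a => (e a).1.1)
    (fun a b h => e.injective (Subtype.ext (Subtype.ext h))) (fun a => (e a).2)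
    (fun x hx => ⟨⟨⟨x, hξτ hx⟩, hXS hx⟩, rfl⟩) hext
  let t : α ⊕ Fin n → S := fun i => ⟨⟨s i, hξτ (hs i)⟩, hXS (hs i)⟩
  have ht : π ∘ Sum.elim (t ∘ Sum.inl) (t ∘ Sum.inr) = s := by
    rw [Sum.elim_comp_inl_inr]
    funext i
    exact hπfix _ (hs i)
  have hreal : φ.Realize (S.subtype ∘ t ∘ Sum.inl) (S.subtype ∘ t ∘ Sum.inr) := by
    rw [realize_world]
    convert hτ using 1
    funext i
    rcases i with i | i <;> rfl
  rw [S.subtype.map_boundedFormula,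
    realize_iff_sat π hπ (fun xs => (hmemι xs).trans (hπmem _ _).symm), ht] at hreal
  refine sigma_one_upward hφ hπT (transClass_vonNeumann l) ?_ (fun i => ?_) hreal
  · rintro _ ⟨a, rfl⟩
    exact hπl a
  · rw [← ht]
    exact ⟨_, rfl⟩

end SigmaOne

/-! ### The maximality principle implies `Σ₃`-correctness -/

section MaximalityImpliesCorrect

variable {α β : Type*} {m n N : ℕ}

/-- The literal negation of a prenex formula is not prenex, so the negation is pushed through the
quantifier blocks. -/
theorem isSigma_isPi_not (k : ℕ) :
    (∀ n (φ : LSet.BoundedFormula α n), IsSigma k n φ → ∃ ψ, IsPi k n ψ ∧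
      ∀ (A : Set ZFSet.{u}) s, Sat A ψ s ↔ ¬ Sat A φ s) ∧
    (∀ n (φ : LSet.BoundedFormula α n), IsPi k n φ → ∃ ψ, IsSigma k n ψ ∧
      ∀ (A : Set ZFSet.{u}) s, Sat A ψ s ↔ ¬ Sat A φ s) := by
  induction k with
  | zero => exact ⟨fun n φ h => ⟨∼φ, IsDelta0.not h, fun A s => Iff.rfl⟩,
      fun n φ h => ⟨∼φ, IsDelta0.not h, fun A s => Iff.rfl⟩⟩
  | succ k ih =>
    constructor
    · intro n φ h
      induction h with
      | base h =>
        obtain ⟨ψ, hψ, h⟩ := ih.2 _ _ h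
        exact ⟨ψ, .base hψ, h⟩
      | ex _ ih =>
        obtain ⟨ψ, hψ, h⟩ := ih
        refine ⟨ψ.all, .all hψ, fun A s => ?_⟩
        rw [sat_all, sat_ex]
        simp [h]
    · intro n φ h
      induction h with
      | base h =>
        obtain ⟨ψ, hψ, h⟩ := ih.1 _ _ h
        exact ⟨ψ, .base hψ, h⟩
      | all _ ih =>
        obtain ⟨ψ, hψ, h⟩ := ih
        refine ⟨ψ.ex, .ex hψ, fun A s => ?_⟩
        rw [sat_all, sat_ex]
        simp [h]

/-- True `Σ₁` assertions about elements of `V_δ` are true in `V_δ`. -/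
def SigmaOneCorrect (δ : Ordinal.{u}) : Prop :=
  ∀ (m n : ℕ) (φ : LSet.BoundedFormula (Fin m) n), IsSigma 1 n φ →
    ∀ s : Fin m ⊕ Fin n → ZFSet.{u}, (∀ i, s i ∈ V_ δ) → Sat Set.univ φ s →
      Sat (V_ δ : Set ZFSet.{u}) φ s

theorem SigmaOneCorrect.sat_univ_of_pi_one {δ : Ordinal.{u}} (hδ : SigmaOneCorrect δ)
    {φ : LSet.BoundedFormula (Fin m) n} (hφ : IsPi 1 n φ) {s : Fin m ⊕ Fin n → ZFSet.{u}}
    (hs : ∀ i, s i ∈ V_ δ) (h : Sat (V_ δ : Set ZFSet.{u}) φ s) : Sat Set.univ φ s := by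
  obtain ⟨ψ, hψ, hneg⟩ := (isSigma_isPi_not.{u} 1).2 _ _ hφ
  by_contra hc
  exact (hneg _ s).1 (hδ m n ψ hψ s hs ((hneg _ s).2 hc)) h

theorem SigmaOneCorrect.sat_of_pi_two {δ : Ordinal.{u}} (hδ : SigmaOneCorrect δ)
    {φ : LSet.BoundedFormula (Fin m) n} (hφ : IsPi 2 n φ) {s : Fin m ⊕ Fin n → ZFSet.{u}}
    (hs : ∀ i, s i ∈ V_ δ) (h : Sat Set.univ φ s) : Sat (V_ δ : Set ZFSet.{u}) φ s := by
  induction hφ with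
  | base hφ => exact hδ _ _ _ hφ s hs h
  | all _ ih =>
    exact fun x hx => ih (assign_mem (A := (V_ δ : Set ZFSet.{u})) hs hx) (h x trivial)

/-- The `Π₁` kernel goes from `V_l` up to `V` by `Σ₁`-correctness of `l`, then down to `V_δ` by
absoluteness; nothing is required of `δ` beyond `l ≤ δ`. -/
theorem SigmaOneCorrect.sat_of_sigma_two {l δ : Ordinal.{u}} (hl : SigmaOneCorrect l) (hlδ : l ≤ δ)
    {φ : LSet.BoundedFormula (Fin m) n} (hφ : IsSigma 2 n φ) {s : Fin m ⊕ Fin n → ZFSet.{u}}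
    (hs : ∀ i, s i ∈ V_ l) (h : Sat (V_ l : Set ZFSet.{u}) φ s) :
    Sat (V_ δ : Set ZFSet.{u}) φ s := by
  induction hφ with
  | base hφ =>
    exact pi_one_downward hφ (transClass_vonNeumann δ) transClass_univ (Set.subset_univ _)
      (fun i => vonNeumann_subset_coe hlδ (hs i)) (hl.sat_univ_of_pi_one hφ hs h)
  | ex _ ih =>
    rw [sat_ex] at h ⊢
    obtain ⟨x, hx, h⟩ := h
    exact ⟨x, vonNeumann_subset_coe hlδ hx, ih (assign_mem (A := (V_ l : Set ZFSet.{u})) hs hx) h⟩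

/-- A true `Σ₂` formula is true in all sufficiently large worlds. -/
theorem sigma_two_eventually {φ : LSet.BoundedFormula α n} (hφ : IsSigma 2 n φ)
    {b : Ordinal.{u}} {s : α ⊕ Fin n → ZFSet.{u}} (hs : ∀ i, s i ∈ V_ b)
    (h : Sat Set.univ φ s) : ∃ γ, ∀ τ ≥ γ, Sat (V_ τ : Set ZFSet.{u}) φ s := by
  induction hφ generalizing b with
  | base hφ =>
    exact ⟨b, fun τ hτ => pi_one_downward hφ (transClass_vonNeumann τ) transClass_univ
      (Set.subset_univ _) (fun i => vonNeumann_subset_coe hτ (hs i)) h⟩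
  | ex _ ih =>
    simp only [sat_ex] at h ⊢
    obtain ⟨x, -, h⟩ := h
    obtain ⟨ξ, hξ⟩ := ZFSet.exists_mem_vonNeumann x
    obtain ⟨γ, hγ⟩ := ih (b := max b ξ) (assign_mem (A := (V_ (max b ξ) : Set ZFSet.{u}))
      (fun i => vonNeumann_subset_coe (le_max_left _ _) (hs i))
      (vonNeumann_subset_coe (le_max_right _ _) hξ)) h
    exact ⟨max γ ξ, fun τ hτ => ⟨x, vonNeumann_subset_coe (le_trans (le_max_right _ _) hτ) hξ,
      hγ τ (le_trans (le_max_left _ _) hτ)⟩⟩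

theorem exists_bound {ι : Type*} [Fintype ι] {δ : Ordinal.{u}} (h0 : 0 < δ)
    (hδ : ∀ ξ < δ, ξ + 1 < δ) {s : ι → ZFSet.{u}} (hs : ∀ i, s i ∈ V_ δ) :
    ∃ ξ < δ, ∀ i, s i ∈ V_ ξ := by
  refine ⟨Finset.univ.sup fun i => (s i).rank + 1, ?_, fun i => ?_⟩
  · rw [Finset.sup_lt_iff (by simpa using h0)]
    exact fun i _ => hδ _ (ZFSet.mem_vonNeumann.1 (hs i))
  · rw [ZFSet.mem_vonNeumann]
    exact (Order.lt_add_one_iff.2 le_rfl).trans_le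
      (Finset.le_sup (f := fun i => (s i).rank + 1) (Finset.mem_univ i))

theorem HasCollapses.sigmaOneCorrect {l : Ordinal.{u}}
    (hl : HasCollapses (V_ l : Set ZFSet.{u})) : SigmaOneCorrect l := by
  intro m n φ hφ s hs h
  obtain ⟨ξ, hξ, hsξ⟩ := exists_bound (Ordinal.omega0_pos.trans hl.omega0_lt)
    (fun ξ hξ => hl.succ_lt hξ) hs
  exact hl.sat_of_sigma_one hφ hξ hsξ h

/-! #### Assertions about the worlds with collapses -/

/-- `w` is a world with collapses. -/
def collapseWorldFormula (w : β ⊕ Fin N) : LSet.BoundedFormula β N :=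
  levelFormula w ⊓ relativize w (Sum.elim Empty.elim Fin.elim0) (collapsesSentence Empty)

theorem exists_of_sat_collapseWorld {γ : Ordinal.{u}} {s : β ⊕ Fin N → ZFSet.{u}} {w : β ⊕ Fin N}
    (hw : s w ∈ V_ γ) (h : Sat (V_ γ : Set ZFSet.{u}) (collapseWorldFormula w) s) :
    ∃ l < γ, s w = V_ l ∧ HasCollapses (V_ l : Set ZFSet.{u}) := by
  rw [collapseWorldFormula, sat_inf, sat_relativize (transClass_vonNeumann γ) _ _ _ _ hw] at h
  have hl := eq_vonNeumann_of_sat_level h.1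
  refine ⟨_, ZFSet.mem_vonNeumann.1 hw, hl, ?_⟩
  rw [← hl]
  exact (sat_collapsesSentence (hl ▸ transClass_vonNeumann _) _).1 h.2

theorem lt_of_add_two_le {l γ : Ordinal.{u}} (h : l + 2 ≤ γ) : l < γ := by
  refine lt_of_lt_of_le ?_ h
  rw [← one_add_one_eq_two, ← add_assoc]
  exact (Order.lt_add_one_iff.2 le_rfl).trans (Order.lt_add_one_iff.2 le_rfl)

/-- The gap of 2 leaves room in `V_γ` for the history of `V_l`; the converse
`exists_of_sat_collapseWorld` needs no gap. -/
theorem sat_collapseWorld {γ l : Ordinal.{u}} (hl : HasCollapses (V_ l : Set ZFSet.{u}))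
    (hlγ : l + 2 ≤ γ) {s : β ⊕ Fin N → ZFSet.{u}} {w : β ⊕ Fin N} (hw : s w = V_ l) :
    Sat (V_ γ : Set ZFSet.{u}) (collapseWorldFormula w) s := by
  rw [collapseWorldFormula, sat_inf, sat_relativize (transClass_vonNeumann γ) _ _ _ _
    (by rw [hw]; exact ZFSet.vonNeumann_mem_of_lt (lt_of_add_two_le hlγ))]
  refine ⟨sat_level_of_eq hlγ hw, ?_⟩
  rw [hw]
  exact (sat_collapsesSentence (transClass_vonNeumann _) _).2 hl

/-- The formula `φ` holds in some world with collapses that contains `b`. -/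
def someCollapseWorld (b : β ⊕ Fin N) (f : α ⊕ Fin n → β ⊕ Fin N) (φ : LSet.BoundedFormula α n) :
    LSet.BoundedFormula β N :=
  (collapseWorldFormula top ⊓ (memFormula (up b) top ⊓ relativize top (up ∘ f) φ)).ex

/-- The formula `φ` holds in all worlds with collapses that contain `b`. -/
def allCollapseWorlds (b : β ⊕ Fin N) (f : α ⊕ Fin n → β ⊕ Fin N) (φ : LSet.BoundedFormula α n) :
    LSet.BoundedFormula β N :=
  ((collapseWorldFormula top ⊓ memFormula (up b) top).imp (relativize top (up ∘ f) φ)).all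

variable {b : β ⊕ Fin N} {f : α ⊕ Fin n → β ⊕ Fin N} {φ : LSet.BoundedFormula α n}
  {s : β ⊕ Fin N → ZFSet.{u}}

theorem sat_relativize_top {γ : Ordinal.{u}} {W : ZFSet.{u}} (hW : W ∈ V_ γ) :
    Sat (V_ γ : Set ZFSet.{u}) (relativize top (up ∘ f) φ) (assign s W) ↔
      Sat (W : Set ZFSet.{u}) φ (s ∘ f) := by
  rw [sat_relativize (transClass_vonNeumann γ) _ _ _ _ (by simpa using hW), assign_top,
    ← Function.comp_assoc, assign_comp_up]

theorem exists_of_sat_someCollapseWorld {γ : Ordinal.{u}}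
    (h : Sat (V_ γ : Set ZFSet.{u}) (someCollapseWorld b f φ) s) :
    ∃ l < γ, HasCollapses (V_ l : Set ZFSet.{u}) ∧ s b ∈ V_ l ∧
      Sat (V_ l : Set ZFSet.{u}) φ (s ∘ f) := by
  rw [someCollapseWorld, sat_ex] at h
  obtain ⟨W, hW, h⟩ := h
  rw [sat_inf, sat_inf, sat_relativize_top hW, sat_mem, assign_top, assign_up] at h
  obtain ⟨l, hl, hWl, hc⟩ := exists_of_sat_collapseWorld (by simpa using hW) h.1
  rw [assign_top] at hWl
  subst hWl
  exact ⟨l, hl, hc, h.2⟩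

theorem sat_someCollapseWorld {γ l : Ordinal.{u}} (hl : HasCollapses (V_ l : Set ZFSet.{u}))
    (hlγ : l + 2 ≤ γ) (hb : s b ∈ V_ l) (h : Sat (V_ l : Set ZFSet.{u}) φ (s ∘ f)) :
    Sat (V_ γ : Set ZFSet.{u}) (someCollapseWorld b f φ) s := by
  have hW := ZFSet.vonNeumann_mem_of_lt (lt_of_add_two_le hlγ)
  rw [someCollapseWorld, sat_ex]
  refine ⟨V_ l, hW, ?_⟩
  rw [sat_inf, sat_inf, sat_relativize_top hW, sat_mem, assign_top, assign_up]
  exact ⟨sat_collapseWorld hl hlγ (by simp), hb, h⟩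

theorem sat_of_sat_allCollapseWorlds {γ l : Ordinal.{u}}
    (h : Sat (V_ γ : Set ZFSet.{u}) (allCollapseWorlds b f φ) s)
    (hl : HasCollapses (V_ l : Set ZFSet.{u})) (hlγ : l + 2 ≤ γ) (hb : s b ∈ V_ l) :
    Sat (V_ l : Set ZFSet.{u}) φ (s ∘ f) := by
  have hW := ZFSet.vonNeumann_mem_of_lt (lt_of_add_two_le hlγ)
  have h' := h (V_ l) hW
  rw [sat_imp, sat_inf, sat_relativize_top hW, sat_mem, assign_top, assign_up] at h'
  exact h' ⟨sat_collapseWorld hl hlγ (by simp), hb⟩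

theorem sat_allCollapseWorlds {γ : Ordinal.{u}} (h : ∀ l, HasCollapses (V_ l : Set ZFSet.{u}) →
    s b ∈ V_ l → Sat (V_ l : Set ZFSet.{u}) φ (s ∘ f)) :
    Sat (V_ γ : Set ZFSet.{u}) (allCollapseWorlds b f φ) s := by
  rw [allCollapseWorlds, sat_all]
  intro W hW
  rw [sat_imp, sat_inf, sat_relativize_top hW, sat_mem, assign_top, assign_up]
  rintro ⟨hc, hbW⟩
  obtain ⟨l, -, hWl, hl⟩ := exists_of_sat_collapseWorld (by simpa using hW) hc
  rw [assign_top] at hWl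
  subst hWl
  exact h l hl hbW

-- Reflection of eventual truth and its consequences

/-- The axiom `◇□p → p` is valid at `V_δ` if and only if eventual truth of an assertion implies its
truth in `V_δ`. -/
theorem diaBox_mem_valParam_iff {δ : Ordinal.{u}} :
    ((ModalFormula.var 0).box.dia.imp (ModalFormula.var 0) ∈ valParam δ) ↔
      ∀ φ : LSet.Formula (World δ), (∃ b, ∀ γ ≥ b, Holds φ (fun a => a.1) γ) →
        Holds φ (fun a => a.1) δ := by
  rw [valParam, mem_validities]
  constructor
  · rintro h φ ⟨b, hb⟩
    refine h (fun _ => φ) fun hc => hc (max b δ) (le_max_right _ _) fun γ hγ => ?_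
    exact hb γ ((le_max_left _ _).trans hγ)
  · intro h ψ hdia
    refine h (ψ 0) ?_
    by_contra hc
    exact hdia fun γ _ hbox => hc ⟨γ, hbox⟩

theorem holds_of_eventually {δ : Ordinal.{u}}
    (hδ : (ModalFormula.var 0).box.dia.imp (ModalFormula.var 0) ∈ valParam δ)
    (φ : LSet.Formula α) (s : α → ZFSet.{u}) (hs : ∀ i, s i ∈ V_ δ)
    (h : ∃ b, ∀ γ ≥ b, Holds φ s γ) : Holds φ s δ := by
  let g : α → World δ := fun i => ⟨s i, hs i⟩
  have key : ∀ γ ≥ δ, (Holds (φ.relabel g) (fun a => a.1) γ ↔ Holds φ s γ) := by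
    intro γ hγ
    let v : World δ → World γ := fun a => ⟨a.1, vonNeumann_subset_coe hγ a.2⟩
    have h₁ := holds_iff_realize (φ.relabel g) v
    rw [Formula.realize_relabel, ← holds_iff_realize] at h₁
    exact h₁
  obtain ⟨b, hb⟩ := h
  rw [← key δ le_rfl]
  refine diaBox_mem_valParam_iff.1 hδ _ ⟨max b δ, fun γ hγ => ?_⟩
  exact (key γ ((le_max_right _ _).trans hγ)).2 (hb γ ((le_max_left _ _).trans hγ))

section

variable {δ : Ordinal.{u}}

theorem pos_of_diaBox (hδ : (ModalFormula.var 0).box.dia.imp (ModalFormula.var 0) ∈ valParam δ) :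
    0 < δ := by
  have := holds_of_eventually hδ (α := Empty) (BoundedFormula.ex (∼ ⊥)) Empty.elim
    (fun i => i.elim) ⟨1, fun γ hγ => by
      rw [Holds, sat_ex]
      exact ⟨∅, ZFSet.mem_vonNeumann.2 (by
        rw [ZFSet.rank_empty]
        exact zero_lt_one.trans_le hγ), id⟩⟩
  rw [Holds, sat_ex] at this
  obtain ⟨x, hx, -⟩ := this
  exact zero_le.trans_lt (ZFSet.mem_vonNeumann.1 hx)

/-- "Some collapse world contains `V_ξ`" is eventually true, so it holds in `V_δ`: collapse worlds
are cofinal below `δ`. -/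
theorem exists_collapseWorld_of_diaBox
    (hδ : (ModalFormula.var 0).box.dia.imp (ModalFormula.var 0) ∈ valParam δ) {ξ : Ordinal.{u}}
    (hξ : ξ < δ) : ∃ l < δ, ξ < l ∧ HasCollapses (V_ l : Set ZFSet.{u}) := by
  have := holds_of_eventually hδ (α := Unit)
    (someCollapseWorld (α := Unit) (n := 0) (Sum.inl ()) id (∼ ⊥)) (fun _ => V_ ξ)
    (fun _ => ZFSet.vonNeumann_mem_of_lt hξ) (by
      obtain ⟨l, hξl, hl⟩ := exists_hasCollapses (ξ + 1)
      exact ⟨l + 2, fun γ hγ => sat_someCollapseWorld hl hγ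
        (ZFSet.vonNeumann_mem_of_lt ((Order.lt_add_one_iff.2 le_rfl).trans_le hξl)) id⟩)
  obtain ⟨l, hlδ, hl, hξl, -⟩ := exists_of_sat_someCollapseWorld this
  exact ⟨l, hlδ, ZFSet.vonNeumann_mem_vonNeumann_iff.1 hξl, hl⟩

theorem succ_lt_of_diaBox
    (hδ : (ModalFormula.var 0).box.dia.imp (ModalFormula.var 0) ∈ valParam δ) (ξ : Ordinal.{u})
    (hξ : ξ < δ) : ξ + 1 < δ := by
  obtain ⟨l, hl, hξl, -⟩ := exists_collapseWorld_of_diaBox hδ hξ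
  exact (Order.add_one_le_of_lt hξl).trans_lt hl

theorem sat_of_sigma_two_of_diaBox
    (hδ : (ModalFormula.var 0).box.dia.imp (ModalFormula.var 0) ∈ valParam δ)
    {φ : LSet.BoundedFormula (Fin m) n} (hφ : IsSigma 2 n φ) {s : Fin m ⊕ Fin n → ZFSet.{u}}
    (hs : ∀ i, s i ∈ V_ δ) (h : Sat Set.univ φ s) : Sat (V_ δ : Set ZFSet.{u}) φ s := by
  obtain ⟨ξ, hξ, hsξ⟩ := exists_bound (pos_of_diaBox hδ) (succ_lt_of_diaBox hδ) hs
  obtain ⟨γ, hγ⟩ := sigma_two_eventually hφ hs h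
  -- All variables of `φ`, bound-style ones included, become parameters `some i`; `none` names
  -- `V_ξ`, which keeps the collapse world above the parameters.
  have := holds_of_eventually hδ (α := Option (Fin m ⊕ Fin n))
    (someCollapseWorld (Sum.inl none) (fun i => Sum.inl (some i)) φ) (fun i => i.elim (V_ ξ) s)
    (fun i => by
      cases i with
      | none => exact ZFSet.vonNeumann_mem_of_lt hξ
      | some i => exact hs i) (by
      obtain ⟨l, hle, hl⟩ := exists_hasCollapses (max γ (ξ + 1))
      exact ⟨l + 2, fun τ hτ => sat_someCollapseWorld hl hτ
        (ZFSet.vonNeumann_mem_of_lt ((Order.lt_add_one_iff.2 le_rfl).trans_le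
          ((le_max_right _ _).trans hle))) (hγ l ((le_max_left _ _).trans hle))⟩)
  obtain ⟨l, hlδ, hl, hξl, h'⟩ := exists_of_sat_someCollapseWorld this
  have hξl' : ξ < l := ZFSet.vonNeumann_mem_vonNeumann_iff.1 hξl
  exact hl.sigmaOneCorrect.sat_of_sigma_two hlδ.le hφ
    (fun i => vonNeumann_subset_coe hξl'.le (hsξ i)) h'

theorem sat_univ_of_sigma_three_of_diaBox
    (hδ : (ModalFormula.var 0).box.dia.imp (ModalFormula.var 0) ∈ valParam δ)
    {φ : LSet.BoundedFormula (Fin m) n} (hφ : IsSigma 3 n φ) {s : Fin m ⊕ Fin n → ZFSet.{u}}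
    (hs : ∀ i, s i ∈ V_ δ) (h : Sat (V_ δ : Set ZFSet.{u}) φ s) : Sat Set.univ φ s := by
  induction hφ with
  | base hφ =>
    obtain ⟨ψ, hψ, hneg⟩ := (isSigma_isPi_not.{u} 2).2 _ _ hφ
    by_contra hc
    exact (hneg _ s).1 (sat_of_sigma_two_of_diaBox hδ hψ hs ((hneg _ s).2 hc)) h
  | ex _ ih =>
    rw [sat_ex] at h ⊢
    obtain ⟨x, hx, h⟩ := h
    exact ⟨x, trivial, ih (assign_mem (A := (V_ δ : Set ZFSet.{u})) hs hx) h⟩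

/-- Given values for the universal quantifiers, a collapse world below `δ` contains them, and its
`Σ₁` witnesses still work in `V_δ`. The bound `η` grows with the rank of each value. -/
theorem sat_of_pi_two_of_collapseWorlds
    (hδ : (ModalFormula.var 0).box.dia.imp (ModalFormula.var 0) ∈ valParam δ)
    {φ : LSet.BoundedFormula (Fin m) n} (hφ : IsPi 2 n φ) {s : Fin m ⊕ Fin n → ZFSet.{u}}
    (hs : ∀ i, s i ∈ V_ δ) {η : Ordinal.{u}} (hη : η < δ)
    (h : ∀ l < δ, η < l → HasCollapses (V_ l : Set ZFSet.{u}) → Sat (V_ l : Set ZFSet.{u}) φ s) :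
    Sat (V_ δ : Set ZFSet.{u}) φ s := by
  induction hφ generalizing η with
  | base hφ =>
    obtain ⟨ξ, hξ, hsξ⟩ := exists_bound (pos_of_diaBox hδ) (succ_lt_of_diaBox hδ) hs
    obtain ⟨l, hlδ, hle, hl⟩ := exists_collapseWorld_of_diaBox hδ (max_lt hη hξ)
    exact sigma_one_upward hφ (transClass_vonNeumann l) (transClass_vonNeumann δ)
      (vonNeumann_subset_coe hlδ.le)
      (fun i => vonNeumann_subset_coe ((le_max_right _ _).trans hle.le) (hsξ i))
      (h l hlδ ((le_max_left _ _).trans_lt hle) hl)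
  | all _ ih =>
    intro x hx
    refine ih (assign_mem (A := (V_ δ : Set ZFSet.{u})) hs hx)
      (max_lt hη (ZFSet.mem_vonNeumann.1 hx)) fun l hlδ hle hl => ?_
    exact h l hlδ ((le_max_left _ _).trans_lt hle) hl x
      (ZFSet.mem_vonNeumann.2 ((le_max_right _ _).trans_lt hle))

/-- A true `Σ₃` formula may fail in arbitrarily large worlds, so its `Π₂` kernel is replaced by "for
some `x`, the kernel holds in all collapse worlds containing `x`". This is eventually true when the
kernel is true in `V`, and in `V_δ` it gives the kernel back. -/
theorem exists_eventual_formula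
    (hδ : (ModalFormula.var 0).box.dia.imp (ModalFormula.var 0) ∈ valParam δ)
    {φ : LSet.BoundedFormula (Fin m) n} (hφ : IsSigma 3 n φ) :
    ∃ ψ : LSet.BoundedFormula (Fin m) n,
      (∀ (b : Ordinal.{u}) s, (∀ i, s i ∈ V_ b) → Sat Set.univ φ s →
        ∃ c, ∀ γ ≥ c, Sat (V_ γ : Set ZFSet.{u}) ψ s) ∧
      ∀ s, (∀ i, s i ∈ V_ δ) → Sat (V_ δ : Set ZFSet.{u}) ψ s →
        Sat (V_ δ : Set ZFSet.{u}) φ s := by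
  induction hφ with
  | @base n φ hφ =>
    refine ⟨(allCollapseWorlds top up φ).ex, fun b s hs h => ⟨b + 1, fun γ hγ => ?_⟩,
      fun s hs h => ?_⟩
    · rw [sat_ex]
      refine ⟨V_ b, ZFSet.vonNeumann_mem_of_lt ((Order.lt_add_one_iff.2 le_rfl).trans_le hγ),
        sat_allCollapseWorlds fun l hl hb => ?_⟩
      rw [assign_top, ZFSet.vonNeumann_mem_vonNeumann_iff] at hb
      rw [assign_comp_up]
      exact hl.sigmaOneCorrect.sat_of_pi_two hφ (fun i => vonNeumann_subset_coe hb.le (hs i)) h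
    · rw [sat_ex] at h
      obtain ⟨x, hx, h⟩ := h
      refine sat_of_pi_two_of_collapseWorlds hδ hφ hs (ZFSet.mem_vonNeumann.1 hx)
        fun l hlδ hxl hl => ?_
      -- `δ` is a limit, so `V_δ` recognizes every collapse world below it.
      have hl2 : l + 2 ≤ δ := by
        rw [← one_add_one_eq_two, ← add_assoc]
        exact Order.add_one_le_of_lt (succ_lt_of_diaBox hδ l hlδ)
      have := sat_of_sat_allCollapseWorlds h hl hl2
        (by rw [assign_top]; exact ZFSet.mem_vonNeumann.2 hxl)
      rwa [assign_comp_up] at this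
  | ex _ ih =>
    obtain ⟨ψ, h₁, h₂⟩ := ih
    refine ⟨ψ.ex, fun b s hs h => ?_, fun s hs h => ?_⟩
    · rw [sat_ex] at h
      obtain ⟨x, -, h⟩ := h
      obtain ⟨ξ, hξ⟩ := ZFSet.exists_mem_vonNeumann x
      obtain ⟨c, hc⟩ := h₁ (max b ξ) _ (assign_mem (A := (V_ (max b ξ) : Set ZFSet.{u}))
        (fun i => vonNeumann_subset_coe (le_max_left _ _) (hs i))
        (vonNeumann_subset_coe (le_max_right _ _) hξ)) h
      refine ⟨max c ξ, fun γ hγ => ?_⟩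
      rw [sat_ex]
      exact ⟨x, vonNeumann_subset_coe ((le_max_right _ _).trans hγ) hξ,
        hc γ ((le_max_left _ _).trans hγ)⟩
    · rw [sat_ex] at h ⊢
      obtain ⟨x, hx, h⟩ := h
      exact ⟨x, hx, h₂ _ (assign_mem (A := (V_ δ : Set ZFSet.{u})) hs hx) h⟩

theorem sigmaCorrect_of_diaBox
    (hδ : (ModalFormula.var 0).box.dia.imp (ModalFormula.var 0) ∈ valParam δ) :
    SigmaCorrect 3 δ := by
  intro m φ hφ a
  have hs : ∀ i, (Sum.elim (fun i => (a i).1) Fin.elim0 : Fin m ⊕ Fin 0 → ZFSet.{u}) i ∈ V_ δ := by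
    rintro (i | i)
    · exact (a i).2
    · exact i.elim0
  rw [formula_realize_zfset, ← holds_iff_realize]
  refine ⟨sat_univ_of_sigma_three_of_diaBox hδ hφ hs, fun h => ?_⟩
  obtain ⟨ψ, h₁, h₂⟩ := exists_eventual_formula hδ hφ
  exact h₂ _ hs (holds_of_eventually hδ ψ _ (fun i => (a i).2) (h₁ δ _ hs h))

end

/-! ### The class of `Σ₃`-correct ordinals -/

theorem diaBox_mem_of_maximalityPrinciple {δ : Ordinal.{u}} (h : MaximalityPrinciple δ) :
    (ModalFormula.var 0).box.dia.imp (ModalFormula.var 0) ∈ valParam δ :=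
  h (.axiomFive _)

/-- Closure is checked on the reflection property: the finitely many parameters of an assertion lie
in `V_γ` for some `γ ∈ d`, and at `γ` eventual truth yields truth at every larger ordinal, in
particular at the supremum. -/
theorem isClub_sigmaCorrect : IsClub {δ : Ordinal.{u} | SigmaCorrect 3 δ} where
  dirSupClosed := by
    intro d hd hne _ δ hδ
    refine sigmaCorrect_of_diaBox (diaBox_mem_valParam_iff.2 fun φ hφ => ?_)
    by_cases hmem : δ ∈ d
    · exact (hd hmem).holds_of_eventually φ _ (fun a => a.2) hφ δ le_rfl
    have hlt : ∀ γ ∈ d, γ < δ := fun γ hγ => (hδ.1 hγ).lt_of_ne fun h => hmem (h ▸ hγ)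
    obtain ⟨m, g, ψ, hψ⟩ := exists_finite_parameters.{u} φ
    have hψ' : ∀ γ ≥ δ, (Holds φ (fun a : World δ => a.1) γ ↔ Holds ψ (fun i => (g i).1) γ) :=
      fun γ hγ => (holds_iff_realize φ
        (fun a : World δ => (⟨a.1, vonNeumann_subset_coe hγ a.2⟩ : World γ))).trans
          ((hψ γ _).trans (holds_iff_realize ψ _).symm)
    rw [hψ' δ le_rfl]
    have hbound : ∃ γ ∈ d, ∀ i, (g i).1 ∈ V_ γ := by
      have : ∀ i, ∃ γ ∈ d, (g i).1.rank < γ := fun i =>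
        (lt_isLUB_iff hδ).1 (ZFSet.mem_vonNeumann.1 (g i).2)
      choose γ hγ hi using this
      obtain ⟨γ₀, hγ₀⟩ := hne
      by_cases hm : (Finset.univ : Finset (Fin m)).Nonempty
      · obtain ⟨i, -, hmax⟩ := Finset.exists_max_image Finset.univ γ hm
        exact ⟨γ i, hγ i, fun j => ZFSet.mem_vonNeumann.2
          ((hi j).trans_le (hmax j (Finset.mem_univ j)))⟩
      · exact ⟨γ₀, hγ₀, fun i => (hm ⟨i, Finset.mem_univ i⟩).elim⟩
    obtain ⟨γ, hγ, hg⟩ := hbound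
    obtain ⟨b, hb⟩ := hφ
    exact (hd hγ).holds_of_eventually ψ _ hg ⟨max b δ, fun τ hτ =>
      (hψ' τ ((le_max_right _ _).trans hτ)).1 (hb τ ((le_max_left _ _).trans hτ))⟩ δ (hlt γ hγ).le
  isCofinal := by
    intro b
    obtain ⟨l, hl, h⟩ := exists_elementary b
    refine ⟨l, fun m φ _ a => ?_, hl⟩
    rw [formula_realize_zfset, ← holds_iff_realize]
    refine h m 0 φ _ ?_
    rintro (i | i)
    · exact (a i).2
    · exact i.elim0

theorem valParam_eq_s5_iff {δ : Ordinal.{u}} : valParam δ = S5 ↔ SigmaCorrect 3 δ :=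
  ⟨fun h => sigmaCorrect_of_diaBox (diaBox_mem_of_maximalityPrinciple h.ge),
    fun h => h.validities_eq id⟩

end MaximalityImpliesCorrect

end RankPotentialism

theorem mainTheorem2 :
    (∀ δ : Ordinal.{u},
      (RankPotentialism.MaximalityPrinciple δ ↔ RankPotentialism.SigmaCorrect 3 δ) ∧
      (RankPotentialism.valParam δ = RankPotentialism.S5 ↔ RankPotentialism.SigmaCorrect 3 δ) ∧
      ((((RankPotentialism.ModalFormula.var 0).box.dia).imp (RankPotentialism.ModalFormula.var 0) ∈
        RankPotentialism.valParam δ) ↔ RankPotentialism.SigmaCorrect 3 δ) ∧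
      (RankPotentialism.SigmaCorrect 3 δ →
        RankPotentialism.valSentence δ = RankPotentialism.S5)) ∧
    IsClub {δ : Ordinal.{u} | RankPotentialism.SigmaCorrect 3 δ} ∧
    IsClub {δ : Ordinal.{u} | RankPotentialism.valParam δ = RankPotentialism.S5 ∧
      RankPotentialism.valSentence δ = RankPotentialism.S5} := by
  open RankPotentialism in
  refine ⟨fun δ => ⟨⟨fun h => sigmaCorrect_of_diaBox (diaBox_mem_of_maximalityPrinciple h),
    fun h => h.s5_subset_validities id⟩, valParam_eq_s5_iff, ⟨sigmaCorrect_of_diaBox,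
    fun h => h.s5_subset_validities id (.axiomFive _)⟩, fun h => h.validities_eq Empty.elim⟩,
    isClub_sigmaCorrect, ?_⟩
  convert isClub_sigmaCorrect.{u} using 2
  ext δ
  rw [valParam_eq_s5_iff]
  exact ⟨fun h => h.1, fun h => ⟨h, h.validities_eq Empty.elim⟩⟩
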